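/- Let $G\subset\mathbb C$ be a bounded simply connected domain with boundary $\Gamma$, put $\Omega=\mathbb C\setminus\overline G$, $\mathbb D^*=\{w\in\mathbb C:|w|>1\}$, and let $\phi:\Omega\to\mathbb D^*$ be the Riemann map, i.e. a holomorphic bijection with $\phi(z)=\gamma z+\phi_0+\phi_{-1}z^{-1}+\cdots$ near $\infty$, $\gamma>0$ (its existence means that $\Omega$ is connected). Let $\psi=\phi^{-1}:\mathbb D^*\to\Omega$, so $\psi'(\infty)=1/\gamma$. Let the Faber polynomial $F_n$ be the polynomial part of the Laurent expansion of $\phi(z)^n$ at $\infty$, and for $n\ge 0$ put $$f_n(z)=\frac{F_{n+1}'(z)}{\sqrt\pi\,\sqrt{n+1}},\qquad r_n(w)=\psi'(w)f_n(\psi(w))-\sqrt{\frac{n+1}{\pi}}\,w^n\quad(|w|>1).$$ Let the Grunsky coefficients $b_{n,\ell}$ $(n,\ell\ge1)$ be defined by the absolutely convergent expansion $$\log\Bigl(\frac{\psi(w)-\psi(v)}{\psi'(\infty)(w-v)}\Bigr)=-\sum_{n=1}^\infty\sum_{\ell=1}^\infty b_{n,\ell}\,w^{-\ell}v^{-n}\qquad(|w|>1,\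 |v|>1),$$ and let $C=(C_{n,k})_{n,k\ge0}$, $C_{n,k}=\sqrt{n+1}\sqrt{k+1}\,b_{n+1,k+1}$, be the Grunsky matrix. Write $\langle f,g\rangle_{L^2(S)}=\int_S f\,\overline g\,dA$, where $dA$ is planar Lebesgue measure, and let $e_j$, $j\ge0$, be the canonical vectors of $\ell^2$. **Lemma.** If $\Gamma$ has planar Lebesgue measure zero, then the expansion above exists, $f_n\in L^2(G)$ and $r_n\in L^2(\mathbb D^*)$ for all $n\ge0$, $C$ represents a bounded linear operator on $\ell^2$, and for all $n,k\ge 0$ $$\langle f_n,f_k\rangle_{L^2(G)}=\delta_{n,k}-\langle r_n,r_k\rangle_{L^2(\mathbb D^*)}=\delta_{n,k}-e_k^*C^*Ce_n .$$ -/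

import Mathlib

open Set Filter Topology MeasureTheory
open scoped ComplexConjugate

namespace BergmanGrunsky

/-- The (finite points of the) exterior `𝔻*` of the closed unit disk. -/
def exteriorDisk : Set ℂ := {w | 1 < ‖w‖}

/-- The (finite points of the) exterior `Ω` of the closure of `G`. -/
def exteriorDomain (G : Set ℂ) : Set ℂ := (closure G)ᶜ

/-- `φ` is the Riemann map of `Ω` onto `𝔻*` with `φ(z) = γ z + φ₀ + φ₋₁ z⁻¹ + ⋯` at `∞`, `γ > 0`:
a holomorphic bijection between the finite points, normalized by `φ(z) / z → γ` at infinity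
(so that `φ(∞) = ∞` and `φ'(∞) = γ`). These conditions determine `φ` on `Ω`. -/
structure IsExteriorRiemannMap (G : Set ℂ) (φ : ℂ → ℂ) (γ : ℝ) : Prop where
  differentiableOn : DifferentiableOn ℂ φ (exteriorDomain G)
  bijOn : BijOn φ (exteriorDomain G) exteriorDisk
  pos : 0 < γ
  tendsto_infty : Tendsto (fun z => φ z / z) (Bornology.cobounded ℂ) (𝓝 (γ : ℂ))

/-- The inverse map `ψ = φ⁻¹ : 𝔻* → Ω`. -/
noncomputable def exteriorInverse (G : Set ℂ) (φ : ℂ → ℂ) : ℂ → ℂ :=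
  Function.invFunOn φ (exteriorDomain G)

/-- `ζ ↦ (ζ φ(1/ζ))ⁿ`, with its limit `γⁿ` as value at `ζ = 0`. It is analytic at `0`, and its
`m`-th Taylor coefficient there is the coefficient of `z ^ (n - m)` in the Laurent expansion of
`φ(z)ⁿ` at infinity. -/
noncomputable def powAtInfty (φ : ℂ → ℂ) (γ : ℝ) (n : ℕ) : ℂ → ℂ :=
  fun ζ => (if ζ = 0 then (γ : ℂ) else ζ * φ ζ⁻¹) ^ n

/-- The coefficient of `z ^ (n - m)` in the Laurent expansion of `φ(z)ⁿ` at infinity. -/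
noncomputable def laurentCoeffPow (φ : ℂ → ℂ) (γ : ℝ) (n m : ℕ) : ℂ :=
  iteratedDeriv m (powAtInfty φ γ n) 0 / (m.factorial : ℂ)

/-- The Faber polynomial `F_n`: the polynomial part of the Laurent expansion at infinity
of `φ(z)ⁿ`. -/
noncomputable def faberPoly (φ : ℂ → ℂ) (γ : ℝ) (n : ℕ) : Polynomial ℂ :=
  ∑ m ∈ Finset.range (n + 1), Polynomial.monomial (n - m) (laurentCoeffPow φ γ n m)

/-- The normalized Faber derivative `f_n = F_{n+1}' / (√π √(n+1))`. -/
noncomputable def faberDeriv (φ : ℂ → ℂ) (γ : ℝ) (n : ℕ) (z : ℂ) : ℂ :=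
  (faberPoly φ γ (n + 1)).derivative.eval z / ((√Real.pi * √((n : ℝ) + 1) : ℝ) : ℂ)

/-- The residual `r_n(w) = ψ'(w) f_n(ψ(w)) - √((n+1)/π) wⁿ`, for `|w| > 1`. -/
noncomputable def faberResidual (G : Set ℂ) (φ : ℂ → ℂ) (γ : ℝ) (n : ℕ) (w : ℂ) : ℂ :=
  deriv (exteriorInverse G φ) w * faberDeriv φ γ n (exteriorInverse G φ w)
    - ((√(((n : ℝ) + 1) / Real.pi) : ℝ) : ℂ) * w ^ n

/-- `b n l`, `n, l ≥ 1`, are the coefficients of the expansion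
`log ((ψ(w) - ψ(v)) / (ψ'(∞) (w - v))) = - ∑_{n ≥ 1} ∑_{l ≥ 1} b n l w⁻ˡ v⁻ⁿ`, `|w|, |v| > 1`,
absolutely convergent, with `ψ'(∞) = 1 / γ`. The logarithm is written through `exp`: its branch
is the one given by the series, which vanishes at infinity. The coefficients `b n l` with
`n, l ≥ 1` are thereby unique; the values at `n = 0` or `l = 0` play no role. -/
def IsGrunskyCoeffs (ψ : ℂ → ℂ) (γ : ℝ) (b : ℕ → ℕ → ℂ) : Prop :=
  ∀ w ∈ exteriorDisk, ∀ v ∈ exteriorDisk,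
    Summable (fun p : ℕ × ℕ => b (p.1 + 1) (p.2 + 1) * w⁻¹ ^ (p.2 + 1) * v⁻¹ ^ (p.1 + 1)) ∧
    (w ≠ v →
      Complex.exp
        (-∑' p : ℕ × ℕ, b (p.1 + 1) (p.2 + 1) * w⁻¹ ^ (p.2 + 1) * v⁻¹ ^ (p.1 + 1))
        = (ψ w - ψ v) / ((γ : ℂ)⁻¹ * (w - v)))

/-- The Grunsky coefficients `b_{n,l}` of `ψ = φ⁻¹`. -/
noncomputable def grunskyCoeff (G : Set ℂ) (φ : ℂ → ℂ) (γ : ℝ) : ℕ → ℕ → ℂ :=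
  Classical.epsilon (IsGrunskyCoeffs (exteriorInverse G φ) γ)

/-- The infinite Grunsky matrix, `C_{n,k} = √(n+1) √(k+1) b_{n+1,k+1}`, `n, k ≥ 0`. -/
noncomputable def grunskyMatrix (G : Set ℂ) (φ : ℂ → ℂ) (γ : ℝ) : Matrix ℕ ℕ ℂ :=
  fun n k => ((√((n : ℝ) + 1) * √((k : ℝ) + 1) : ℝ) : ℂ) * grunskyCoeff G φ γ (n + 1) (k + 1)

/-- The complex Hilbert space `ℓ²`. -/
abbrev Ell2 : Type := lp (fun _ : ℕ => ℂ) 2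

/-- The canonical vectors `e_j` of `ℓ²`. -/
noncomputable def e (j : ℕ) : Ell2 := lp.single 2 j (1 : ℂ)

/-- The bounded operator `T` on `ℓ²` has the infinite matrix `A = (⟨T e_k, e_j⟩)_{j,k}`.
(Mathlib's inner product is conjugate linear in its first argument.) -/
def HasMatrix (T : Ell2 →L[ℂ] Ell2) (A : Matrix ℕ ℕ ℂ) : Prop :=
  ∀ j k : ℕ, inner ℂ (e j) (T (e k)) = A j k

/-- `⟨f, g⟩_{L²(S)} = ∫_S f(z) conj(g(z)) dA(z)`, for planar Lebesgue measure. -/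
noncomputable def l2Inner (S : Set ℂ) (f g : ℂ → ℂ) : ℂ :=
  ∫ z in S, f z * conj (g z)

end BergmanGrunsky

/-! Existence of the expansion. Removability at infinity gives `γ ψ(1/s) = 1/s + h(s)` with `h`
holomorphic on the unit disk. With `s = 1/w`, `t = 1/v`, the quotient under the logarithm is `1 - s
t (h(s) - h(t)) / (s - t)`, a double power series on the bidisk equal to `1` on both axes. It has no
zeros: off the diagonal because `ψ` is injective, on it because `ψ' ≠ 0`. So it is the exponential
of a double power series (`exists_log`), whose coefficients are unique, and symmetric since the
quotient is.

Faber polynomials. Logarithmic differentiation of the generating function in `1/v` gives a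
recurrence showing that `w^(n+1) + (n+1) ∑ b_{n+1,l} w^(-l)` is a polynomial in `ψ(w)`. It differs
from `F_{n+1}(ψ(w))` by a quantity tending to `0` at infinity, so the two polynomials coincide
(`faberPoly_eval_inverse`).

Area formula. If `P(ψ(w)) = w^N + ∑ u_l w^(-l-1)` and `Q(ψ(w)) = w^K + ∑ v_l w^(-l-1)`, Green's
formula inside the level curve `|φ| = r` gives `∫ P' conj(Q') = π (N δ_{NK} r^(2N) - ∑ (l+1) u_l
conj(v_l) r^(-2l-2))`. Level curves are avoided by averaging over `r` with a cut-off `χ(|φ|²)`: one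
integrates by parts in the whole plane, changes variables by `ψ`, and applies Parseval on circles
(`exists_weight`). For `P = Q` positivity of the left side yields `∑ (l+1) |u_l|² ≤ N`
(`summable_sq`); this makes the right side continuous down to `r = 1`, and the limit is the integral
over `closure G` (`integral_closure`), hence over `G` when `Γ` is null.

Conclusion. For Faber polynomials the formula reads `⟨f_n, f_k⟩ = δ_{nk} - ⟨row_n, row_k⟩`, the rows
being those of the Grunsky matrix. Differentiating the Laurent expansion shows that `r_n` has
coefficients `-C_{n,l}` in the orthonormal system `√((l+1)/π) w^(-l-2)`, so `⟨r_n, r_k⟩ = ⟨row_n,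
row_k⟩`. By symmetry rows are columns, and the identity `‖C x‖² + ‖∑ x_n f_n‖² = ‖x‖²` for finitely
supported `x` makes `C` a contraction. -/

namespace BergmanGrunsky

/-! ### Power series on disks centred at the origin -/

/-- `f` is the sum of the power series with coefficients `a` on the disk `‖s‖ < R`. -/
def HasSeriesOn (R : ℝ) (f : ℂ → ℂ) (a : ℕ → ℂ) : Prop :=
  ∀ s : ℂ, ‖s‖ < R → HasSum (fun n => a n * s ^ n) (f s)

theorem _root_.DifferentiableOn.hasSeriesOn {R : ℝ} {f : ℂ → ℂ}
    (hf : DifferentiableOn ℂ f (Metric.ball 0 R)) :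
    HasSeriesOn R f (fun n => iteratedDeriv n f 0 / (n.factorial : ℂ)) := by
  intro s hs
  have := Complex.hasSum_taylorSeries_on_ball hf (z := s) (by simpa using hs)
  refine this.congr_fun fun n => ?_
  simp only [smul_eq_mul, sub_zero]
  ring

namespace HasSeriesOn

variable {R : ℝ} {f g : ℂ → ℂ} {a b : ℕ → ℂ}

theorem mono (hf : HasSeriesOn R f a) {r : ℝ} (hr : r ≤ R) : HasSeriesOn r f a :=
  fun s hs => hf s (hs.trans_le hr)

theorem congr (hf : HasSeriesOn R f a) (h : ∀ s, ‖s‖ < R → f s = g s) : HasSeriesOn R g a :=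
  fun s hs => h s hs ▸ hf s hs

theorem hasFPowerSeriesOnBall (hf : HasSeriesOn R f a) (hR : 0 < R) :
    HasFPowerSeriesOnBall f (FormalMultilinearSeries.ofScalars ℂ a) 0 (ENNReal.ofReal R) where
  r_le := by
    refine ENNReal.le_of_forall_nnreal_lt fun r hr => ?_
    have hr' : ‖((r : ℝ) : ℂ)‖ < R := by
      simpa using (ENNReal.coe_lt_ofReal.1 hr)
    refine FormalMultilinearSeries.le_radius_of_summable_norm _ ?_
    have := (hf _ hr').summable.norm
    simpa using this
  r_pos := by simpa using hR
  hasSum := by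
    intro y hy
    have hy' : ‖y‖ < R := by
      simpa [Metric.mem_eball, edist_zero_right, ← ofReal_norm, ENNReal.ofReal_lt_ofReal_iff hR] using hy
    simpa [FormalMultilinearSeries.ofScalars_apply_eq, mul_comm] using hf y hy'

theorem differentiableOn (hf : HasSeriesOn R f a) : DifferentiableOn ℂ f (Metric.ball 0 R) := by
  rcases le_or_gt R 0 with hR | hR
  · rw [Metric.ball_eq_empty.2 hR]
    exact differentiableOn_empty
  · simpa [Metric.eball_ofReal] using (hf.hasFPowerSeriesOnBall hR).differentiableOn

theorem unique (hf : HasSeriesOn R f a) (hg : HasSeriesOn R f b) (hR : 0 < R) : a = b := by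
  have := (hf.hasFPowerSeriesOnBall hR).hasFPowerSeriesAt.eq_formalMultilinearSeries
    (hg.hasFPowerSeriesOnBall hR).hasFPowerSeriesAt
  exact (FormalMultilinearSeries.ofScalars_series_eq_iff (E := ℂ) a b).1 this

theorem coeff_eq (hf : HasSeriesOn R f a) (hR : 0 < R) (n : ℕ) :
    a n = iteratedDeriv n f 0 / (n.factorial : ℂ) :=
  congrFun (hf.unique hf.differentiableOn.hasSeriesOn hR) n

theorem apply_zero (hf : HasSeriesOn R f a) (hR : 0 < R) : f 0 = a 0 := by
  simp [hf.coeff_eq hR 0]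

theorem differentiableAt (hf : HasSeriesOn R f a) {s : ℂ} (hs : ‖s‖ < R) :
    DifferentiableAt ℂ f s :=
  hf.differentiableOn.differentiableAt (Metric.isOpen_ball.mem_nhds (by simpa using hs))

theorem deriv (hf : HasSeriesOn R f a) :
    HasSeriesOn R (deriv f) (fun n => (n + 1) * a (n + 1)) := by
  rcases le_or_gt R 0 with hR | hR
  · exact fun s hs => absurd (hs.trans_le hR) (norm_nonneg s).not_gt
  have h := (hf.differentiableOn.deriv Metric.isOpen_ball).hasSeriesOn
  convert h using 2 with n
  rw [hf.coeff_eq hR, iteratedDeriv_succ', Nat.factorial_succ]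
  have : (n : ℂ) + 1 ≠ 0 := by exact_mod_cast n.succ_ne_zero
  have : (n.factorial : ℂ) ≠ 0 := by exact_mod_cast n.factorial_ne_zero
  push_cast
  field_simp

theorem add (hf : HasSeriesOn R f a) (hg : HasSeriesOn R g b) :
    HasSeriesOn R (fun s => f s + g s) (fun n => a n + b n) := fun s hs => by
  simpa [add_mul] using (hf s hs).add (hg s hs)

theorem neg (hf : HasSeriesOn R f a) :
    HasSeriesOn R (fun s => - f s) (fun n => - a n) := fun s hs => by
  simpa using (hf s hs).neg

theorem sub (hf : HasSeriesOn R f a) (hg : HasSeriesOn R g b) :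
    HasSeriesOn R (fun s => f s - g s) (fun n => a n - b n) := fun s hs => by
  simpa [sub_mul] using (hf s hs).sub (hg s hs)

theorem mul (hf : HasSeriesOn R f a) (hg : HasSeriesOn R g b) :
    HasSeriesOn R (fun s => f s * g s)
      (fun n => ∑ k ∈ Finset.range (n + 1), a k * b (n - k)) := fun s hs => by
  have h1 := hf s hs
  have h2 := hg s hs
  have := hasSum_sum_range_mul_of_summable_norm h1.summable.norm h2.summable.norm
  rw [h1.tsum_eq, h2.tsum_eq] at this
  refine this.congr_fun fun n => ?_
  rw [Finset.sum_mul]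
  refine Finset.sum_congr rfl fun k hk => ?_
  have : k + (n - k) = n := by grind
  rw [← congrArg (s ^ ·) this]
  ring

/-- A power series with vanishing constant term, with shifted coefficients. -/
theorem of_succ (hf : HasSeriesOn R f a) (h0 : a 0 = 0) {s : ℂ} (hs : ‖s‖ < R) :
    HasSum (fun n => a (n + 1) * s ^ (n + 1)) (f s) := by
  have := (hasSum_nat_add_iff' (f := fun n => a n * s ^ n) 1).2 (hf s hs)
  simpa [h0] using this

theorem _root_.BergmanGrunsky.hasSeriesOn_succ
    (hf : ∀ s : ℂ, ‖s‖ < R → HasSum (fun n => a n * s ^ (n + 1)) (f s)) :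
    HasSeriesOn R f (fun n => if n = 0 then 0 else a (n - 1)) := by
  intro s hs
  have := (hasSum_nat_add_iff
    (f := fun n => (if n = 0 then 0 else a (n - 1)) * s ^ n) 1 (g := f s)).1 (by simpa using hf s hs)
  simpa using this

/-- Cauchy's estimate on the circle of radius `r`. -/
theorem norm_coeff_le (hf : HasSeriesOn R f a) {r M : ℝ} (hr : 0 < r) (hrR : r < R)
    (hM : ∀ s : ℂ, ‖s‖ = r → ‖f s‖ ≤ M) (n : ℕ) : ‖a n‖ ≤ M / r ^ n := by
  rw [hf.coeff_eq (hr.trans hrR), norm_div, Complex.norm_natCast,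
    div_le_iff₀ (by exact_mod_cast n.factorial_pos), mul_comm, ← mul_div_assoc]
  have hcl : DifferentiableOn ℂ f (closure (Metric.ball 0 r)) := by
    refine hf.differentiableOn.mono ?_
    rw [closure_ball _ hr.ne']
    exact Metric.closedBall_subset_ball hrR
  refine Complex.norm_iteratedDeriv_le_of_forall_mem_sphere_norm_le n hr hcl.diffContOnCl ?_
  intro z hz
  exact hM z (by simpa using hz)

end HasSeriesOn

/-- The recurrence for the Taylor coefficients of a logarithmic derivative. -/
theorem coeff_of_deriv_eq_mul {R : ℝ} {f g : ℂ → ℂ} {a b : ℕ → ℂ} (hR : 0 < R)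
    (hf : HasSeriesOn R f a) (hg : HasSeriesOn R g b) (h0 : a 0 = 1)
    (h : ∀ s, ‖s‖ < R → deriv f s = f s * g s) (n : ℕ) :
    b n = (n + 1) * a (n + 1) - ∑ k ∈ Finset.range n, a (n - k) * b k := by
  have h1 := ((hg.mul hf).congr (g := deriv f)
    fun s hs => by rw [h s hs, mul_comm]).unique hf.deriv hR
  have h2 := congrFun h1 n
  simp only [Finset.sum_range_succ, Nat.sub_self, h0, mul_one] at h2
  rw [← h2]
  simp [mul_comm]

/-! ### Injective holomorphic functions -/

section Injective

variable {U : Set ℂ} {f g : ℂ → ℂ}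

/-- Open mapping theorem; its other alternative, local constancy, contradicts injectivity. -/
theorem map_nhds_of_injOn (hU : IsOpen U) (hf : DifferentiableOn ℂ f U) (hi : InjOn f U)
    {z : ℂ} (hz : z ∈ U) : 𝓝 (f z) ≤ map f (𝓝 z) := by
  refine ((hf.analyticAt (hU.mem_nhds hz)).eventually_constant_or_nhds_le_map_nhds).resolve_left
    fun h => ?_
  have h2 : ∀ᶠ y in 𝓝[≠] z, y ∈ U ∧ f y = f z :=
    ((hU.eventually_mem hz).and h).filter_mono nhdsWithin_le_nhds
  obtain ⟨y, ⟨hyU, hy⟩, hne⟩ := (h2.and self_mem_nhdsWithin).exists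
  exact hne (hi hyU hz hy)

theorem continuousAt_of_leftInvOn (hU : IsOpen U) (hf : DifferentiableOn ℂ f U)
    (hg : LeftInvOn g f U) {z : ℂ} (hz : z ∈ U) : ContinuousAt g (f z) := by
  have h : Tendsto g (map f (𝓝 z)) (𝓝 z) := by
    rw [tendsto_map'_iff]
    refine tendsto_id.congr' ?_
    filter_upwards [hU.mem_nhds hz] with y hy using (hg hy).symm
  have h2 := h.mono_left (map_nhds_of_injOn hU hf hg.injOn hz)
  rwa [ContinuousAt, hg hz]

theorem hasDerivAt_of_leftInvOn (hU : IsOpen U) (hf : DifferentiableOn ℂ f U)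
    (hg : LeftInvOn g f U) {z : ℂ} (hz : z ∈ U) (h0 : deriv f z ≠ 0) :
    HasDerivAt g (deriv f z)⁻¹ (f z) := by
  have hd : HasDerivAt f (deriv f z) (g (f z)) := by
    rw [hg hz]
    exact (hf.differentiableAt (hU.mem_nhds hz)).hasDerivAt
  refine HasDerivAt.of_local_left_inverse (continuousAt_of_leftInvOn hU hf hg hz) hd h0 ?_
  refine map_nhds_of_injOn hU hf hg.injOn hz ?_
  rw [mem_map]
  filter_upwards [hU.mem_nhds hz] with y hy
  simp [hg hy]

/-- Zeros of `f'` are isolated, since otherwise `f` would be constant on a ball. Hence the inverse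
`g` is differentiable on a punctured neighbourhood of `f z` and continuous at `f z`, so analytic
there by removability, and the chain rule `g'(f z) f'(z) = 1` excludes `f'(z) = 0`. -/
theorem deriv_ne_zero_of_leftInvOn (hU : IsOpen U) (hf : DifferentiableOn ℂ f U)
    (hg : LeftInvOn g f U) {z : ℂ} (hz : z ∈ U) : deriv f z ≠ 0 := by
  intro h0
  have hfa := hf.analyticAt (hU.mem_nhds hz)
  have hev : ∀ᶠ y in 𝓝[≠] z, deriv f y ≠ 0 := by
    refine hfa.deriv.eventually_eq_zero_or_eventually_ne_zero.resolve_left fun h => ?_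
    obtain ⟨r, hr, hball⟩ := Metric.eventually_nhds_iff_ball.1 (h.and (hU.eventually_mem hz))
    have hconst : ∀ y ∈ Metric.ball z r, f y = f z := by
      intro y hy
      have hb : DifferentiableOn ℂ f (Metric.ball z r) := hf.mono fun x hx => (hball x hx).2
      refine Metric.isOpen_ball.is_const_of_deriv_eq_zero
        (convex_ball z r).isPreconnected hb (fun x hx => (hball x hx).1) hy (Metric.mem_ball_self hr)
    have h2 : ∀ᶠ y in 𝓝[≠] z, y ∈ Metric.ball z r :=
      nhdsWithin_le_nhds (Metric.ball_mem_nhds z hr)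
    obtain ⟨y, hy, hne⟩ := (h2.and self_mem_nhdsWithin).exists
    exact hne (hg.injOn (hball y hy).2 hz (hconst y hy))
  have hga : AnalyticAt ℂ g (f z) := by
    refine Complex.analyticAt_of_differentiable_on_punctured_nhds_of_continuousAt ?_
      (continuousAt_of_leftInvOn hU hf hg hz)
    rw [eventually_nhdsWithin_iff] at hev ⊢
    have : ∀ᶠ y in map f (𝓝 z), y ∈ ({f z}ᶜ : Set ℂ) → DifferentiableAt ℂ g y := by
      rw [eventually_map]
      filter_upwards [hev, hU.mem_nhds hz] with y hy hyU hne
      refine (hasDerivAt_of_leftInvOn hU hf hg hyU (hy ?_)).differentiableAt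
      rintro rfl
      exact hne rfl
    exact map_nhds_of_injOn hU hf hg.injOn hz this
  have hcomp : HasDerivAt (g ∘ f) (deriv g (f z) * deriv f z) z :=
    hga.differentiableAt.hasDerivAt.comp z hfa.differentiableAt.hasDerivAt
  have hid : HasDerivAt (g ∘ f) 1 z := by
    refine (hasDerivAt_id z).congr_of_eventuallyEq ?_
    filter_upwards [hU.mem_nhds hz] with y hy using hg hy
  simpa [h0] using hcomp.unique hid

end Injective

/-! ### The exterior Riemann map and its inverse -/

theorem isOpen_exteriorDisk : IsOpen exteriorDisk :=
  isOpen_lt continuous_const continuous_norm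

theorem isOpen_exteriorDomain (G : Set ℂ) : IsOpen (exteriorDomain G) :=
  isClosed_closure.isOpen_compl

theorem inv_mem_exteriorDisk {s : ℂ} (h0 : s ≠ 0) (hs : ‖s‖ < 1) : s⁻¹ ∈ exteriorDisk := by
  simp only [exteriorDisk, mem_ofPred_eq, norm_inv]
  exact (one_lt_inv₀ (norm_pos_iff.2 h0)).2 hs

theorem ne_zero_of_mem_exteriorDisk {w : ℂ} (hw : w ∈ exteriorDisk) : w ≠ 0 :=
  norm_pos_iff.1 (zero_lt_one.trans hw)

theorem norm_inv_lt_one {w : ℂ} (hw : w ∈ exteriorDisk) : ‖w⁻¹‖ < 1 := by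
  rw [norm_inv]
  exact inv_lt_one_of_one_lt₀ hw

theorem eventually_mem_exteriorDomain {G : Set ℂ} (hG : Bornology.IsBounded G) :
    ∀ᶠ z in Bornology.cobounded ℂ, z ∈ exteriorDomain G :=
  Bornology.isBounded_def.1 hG.closure

namespace IsExteriorRiemannMap

variable {G : Set ℂ} {φ : ℂ → ℂ} {γ : ℝ}

theorem leftInvOn (hφ : IsExteriorRiemannMap G φ γ) :
    LeftInvOn (exteriorInverse G φ) φ (exteriorDomain G) :=
  hφ.bijOn.injOn.leftInvOn_invFunOn

theorem rightInvOn (hφ : IsExteriorRiemannMap G φ γ) :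
    RightInvOn (exteriorInverse G φ) φ exteriorDisk :=
  hφ.bijOn.surjOn.rightInvOn_invFunOn

theorem mapsTo_inverse (hφ : IsExteriorRiemannMap G φ γ) :
    MapsTo (exteriorInverse G φ) exteriorDisk (exteriorDomain G) :=
  hφ.bijOn.surjOn.mapsTo_invFunOn

theorem injOn_inverse (hφ : IsExteriorRiemannMap G φ γ) :
    InjOn (exteriorInverse G φ) exteriorDisk :=
  hφ.rightInvOn.injOn

theorem image_inverse (hφ : IsExteriorRiemannMap G φ γ) :
    exteriorInverse G φ '' exteriorDisk = exteriorDomain G := by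
  refine Subset.antisymm hφ.mapsTo_inverse.image_subset fun z hz => ?_
  exact ⟨φ z, hφ.bijOn.mapsTo hz, hφ.leftInvOn hz⟩

theorem deriv_ne_zero (hφ : IsExteriorRiemannMap G φ γ) {z : ℂ} (hz : z ∈ exteriorDomain G) :
    deriv φ z ≠ 0 :=
  deriv_ne_zero_of_leftInvOn (isOpen_exteriorDomain G) hφ.differentiableOn hφ.leftInvOn hz

theorem hasDerivAt_inverse (hφ : IsExteriorRiemannMap G φ γ) {w : ℂ} (hw : w ∈ exteriorDisk) :
    HasDerivAt (exteriorInverse G φ) (deriv φ (exteriorInverse G φ w))⁻¹ w := by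
  have := hasDerivAt_of_leftInvOn (isOpen_exteriorDomain G) hφ.differentiableOn hφ.leftInvOn
    (hφ.mapsTo_inverse hw) (hφ.deriv_ne_zero (hφ.mapsTo_inverse hw))
  rwa [hφ.rightInvOn hw] at this

theorem deriv_inverse_ne_zero (hφ : IsExteriorRiemannMap G φ γ) {w : ℂ}
    (hw : w ∈ exteriorDisk) : deriv (exteriorInverse G φ) w ≠ 0 := by
  rw [(hφ.hasDerivAt_inverse hw).deriv]
  exact inv_ne_zero (hφ.deriv_ne_zero (hφ.mapsTo_inverse hw))

theorem differentiableOn_inverse (hφ : IsExteriorRiemannMap G φ γ) :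
    DifferentiableOn ℂ (exteriorInverse G φ) exteriorDisk :=
  fun _ hw => (hφ.hasDerivAt_inverse hw).differentiableAt.differentiableWithinAt

theorem analyticAt_powAtInfty (hφ : IsExteriorRiemannMap G φ γ) (hG : Bornology.IsBounded G)
    (n : ℕ) : AnalyticAt ℂ (powAtInfty φ γ n) 0 := by
  have h1 : AnalyticAt ℂ (fun ζ : ℂ => if ζ = 0 then (γ : ℂ) else ζ * φ ζ⁻¹) 0 := by
    refine Complex.analyticAt_of_differentiable_on_punctured_nhds_of_continuousAt ?_ ?_
    · have hev : ∀ᶠ ζ : ℂ in 𝓝[≠] 0, ζ⁻¹ ∈ exteriorDomain G :=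
        tendsto_inv₀_nhdsNE_zero.eventually (eventually_mem_exteriorDomain hG)
      filter_upwards [hev, self_mem_nhdsWithin] with ζ hζ hne
      have hφd : DifferentiableAt ℂ φ ζ⁻¹ :=
        hφ.differentiableOn.differentiableAt ((isOpen_exteriorDomain G).mem_nhds hζ)
      have : DifferentiableAt ℂ (fun ζ : ℂ => ζ * φ ζ⁻¹) ζ :=
        differentiableAt_id.mul (hφd.comp ζ (differentiableAt_inv hne))
      refine this.congr_of_eventuallyEq ?_
      filter_upwards [isOpen_ne.mem_nhds hne] with x hx
      have hx' : x ≠ 0 := hx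
      simp [hx']
    · rw [continuousAt_iff_punctured_nhds]
      have h := hφ.tendsto_infty.comp tendsto_inv₀_nhdsNE_zero
      simp only [if_true]
      refine h.congr' ?_
      filter_upwards [self_mem_nhdsWithin] with ζ hne
      simp only [mem_compl_iff, mem_singleton_iff] at hne
      simp [hne, mul_comm]
  exact h1.pow n

/-- In the coordinate `ζ = 1/z` the map `φ` becomes `1/φ(1/ζ) = ζ / powAtInfty φ γ 1 ζ`, with
derivative `1/γ ≠ 0` at `0`. It is therefore open there: each `w` near infinity has a preimage near
infinity, which by injectivity of `φ` is `ψ(w)`. -/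
theorem tendsto_inverse (hφ : IsExteriorRiemannMap G φ γ) (hG : Bornology.IsBounded G) :
    Tendsto (exteriorInverse G φ) (Bornology.cobounded ℂ) (Bornology.cobounded ℂ) := by
  have hγ : (γ : ℂ) ≠ 0 := by exact_mod_cast hφ.pos.ne'
  have hp0 : powAtInfty φ γ 1 0 = γ := by simp [powAtInfty]
  have hu : AnalyticAt ℂ (fun ζ => ζ / powAtInfty φ γ 1 ζ) 0 :=
    analyticAt_id.div (hφ.analyticAt_powAtInfty hG 1) (by rw [hp0]; exact hγ)
  have hd : HasStrictDerivAt (fun ζ => ζ / powAtInfty φ γ 1 ζ) ((γ : ℂ)⁻¹) 0 := by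
    have := (hasStrictDerivAt_id (0 : ℂ)).div
      (hφ.analyticAt_powAtInfty hG 1).hasStrictDerivAt (by rw [hp0]; exact hγ)
    have he : (1 * powAtInfty φ γ 1 0 - id 0 * deriv (powAtInfty φ γ 1) 0) /
        powAtInfty φ γ 1 0 ^ 2 = (γ : ℂ)⁻¹ := by
      rw [hp0]
      simp only [id]
      field_simp
      simp
    rwa [he] at this
  have hmap := hd.map_nhds_eq (inv_ne_zero hγ)
  simp only [zero_div] at hmap
  intro s hs
  rw [mem_map]
  have hs' : {ζ : ℂ | ζ ≠ 0 → ζ⁻¹ ∈ s ∧ ζ⁻¹ ∈ exteriorDomain G} ∈ 𝓝 (0 : ℂ) := by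
    have := tendsto_inv₀_nhdsNE_zero.eventually
      ((eventually_mem_exteriorDomain hG).and (show ∀ᶠ z in Bornology.cobounded ℂ, z ∈ s from hs))
    rw [eventually_nhdsWithin_iff] at this
    filter_upwards [this] with ζ h h0 using (h h0).symm
  have himg := image_mem_map (m := fun ζ => ζ / powAtInfty φ γ 1 ζ) hs'
  rw [hmap] at himg
  have htend : Tendsto (fun w : ℂ => w⁻¹) (Bornology.cobounded ℂ) (𝓝 0) :=
    tendsto_inv₀_cobounded
  filter_upwards [htend himg, Bornology.eventually_ne_cobounded (0 : ℂ)] with w hw hw0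
  obtain ⟨ζ, hζ, hζw⟩ := hw
  have hζ0 : ζ ≠ 0 := by
    rintro rfl
    simp at hζw
    exact hw0 hζw.symm
  obtain ⟨h1, h2⟩ := hζ hζ0
  have hφw : φ ζ⁻¹ = w := by
    simp only [powAtInfty, hζ0, if_false, pow_one] at hζw
    rw [← div_div, div_self hζ0, one_div] at hζw
    exact inv_injective hζw
  rw [mem_preimage, ← hφw, hφ.leftInvOn h2]
  exact h1

/-- The inverse map is `γ ψ(1/s) = 1/s + h(s)` with `h` holomorphic in the unit disk. -/
theorem exists_inverse_eq (hφ : IsExteriorRiemannMap G φ γ) (hG : Bornology.IsBounded G) :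
    ∃ h : ℂ → ℂ, DifferentiableOn ℂ h (Metric.ball 0 1) ∧
      ∀ s : ℂ, s ≠ 0 → ‖s‖ < 1 → γ * exteriorInverse G φ s⁻¹ = s⁻¹ + h s := by
  have hγ : (γ : ℂ) ≠ 0 := by exact_mod_cast hφ.pos.ne'
  set ψ := exteriorInverse G φ with hψ
  -- The singularity of `γ s ψ(1/s)` at `0` is removable with value `1`; then `h(s) = (g(s) - 1) /
  -- s`, which is `dslope g 0`.
  set g : ℂ → ℂ := Function.update (fun s => γ * s * ψ s⁻¹) 0 1 with hg
  have hgs : ∀ s : ℂ, s ≠ 0 → g s = γ * s * ψ s⁻¹ := fun s hs => by simp [hg, hs]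
  have hlim : Tendsto (fun s : ℂ => γ * s * ψ s⁻¹) (𝓝[≠] 0) (𝓝 1) := by
    have h1 : Tendsto (fun w => w / ψ w) (Bornology.cobounded ℂ) (𝓝 (γ : ℂ)) := by
      refine (hφ.tendsto_infty.comp (hφ.tendsto_inverse hG)).congr' ?_
      have : ∀ᶠ w in Bornology.cobounded ℂ, w ∈ exteriorDisk :=
        (tendsto_norm_cobounded_atTop.eventually (eventually_gt_atTop 1))
      filter_upwards [this] with w hw
      simp only [Function.comp, hφ.rightInvOn hw, hψ]
    have h2 := ((h1.inv₀ hγ).const_mul (γ : ℂ)).comp (tendsto_inv₀_nhdsNE_zero (α := ℂ))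
    rw [mul_inv_cancel₀ hγ] at h2
    refine h2.congr fun s => ?_
    simp only [Function.comp, inv_div, div_inv_eq_mul]
    ring
  have hgd : DifferentiableOn ℂ g (Metric.ball 0 1) := by
    rw [← Complex.differentiableOn_compl_singleton_and_continuousAt_iff
      (Metric.ball_mem_nhds (0 : ℂ) one_pos)]
    constructor
    · intro s hs
      have hs0 : s ≠ 0 := hs.2
      have hs1 : ‖s‖ < 1 := by simpa using hs.1
      have hd : DifferentiableAt ℂ (fun s => γ * s * ψ s⁻¹) s :=
        ((differentiableAt_const _).mul differentiableAt_id).mul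
          ((hφ.hasDerivAt_inverse (inv_mem_exteriorDisk hs0 hs1)).differentiableAt.comp s
            (differentiableAt_inv hs0))
      refine (hd.congr_of_eventuallyEq ?_).differentiableWithinAt
      filter_upwards [isOpen_ne.mem_nhds hs0] with x hx using hgs x hx
    · exact continuousAt_update_same.2 hlim
  refine ⟨dslope g 0, (Complex.differentiableOn_dslope
    (Metric.ball_mem_nhds (0 : ℂ) one_pos)).2 hgd, fun s hs hs1 => ?_⟩
  rw [dslope_of_ne _ hs, slope_def_field, hgs s hs]
  simp only [hg, Function.update_self, sub_zero]
  field_simp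
  ring

/-- `φⁿ - F_n` vanishes at infinity. -/
theorem tendsto_pow_sub_faberPoly (hφ : IsExteriorRiemannMap G φ γ) (hG : Bornology.IsBounded G)
    (n : ℕ) : Tendsto (fun z => φ z ^ n - (faberPoly φ γ n).eval z) (Bornology.cobounded ℂ)
      (𝓝 0) := by
  obtain ⟨R, hR, hRd⟩ : ∃ R > 0, DifferentiableOn ℂ (powAtInfty φ γ n) (Metric.ball 0 R) := by
    obtain ⟨R, hR, h⟩ := Metric.eventually_nhds_iff_ball.1
      (hφ.analyticAt_powAtInfty hG n).eventually_analyticAt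
    exact ⟨R, hR, fun z hz => (h z hz).differentiableAt.differentiableWithinAt⟩
  have hser := (hRd.hasSeriesOn.hasFPowerSeriesOnBall hR).hasFPowerSeriesAt
  have hO := (hser.isBigO_sub_partialSum_pow (n + 1))
  -- The Taylor remainder of order `n + 1`, multiplied by `ζ^(-n)`, is still `O(ζ)`.
  have hO2 : (fun ζ : ℂ => ζ⁻¹ ^ n * (powAtInfty φ γ n ζ -
      ∑ m ∈ Finset.range (n + 1), laurentCoeffPow φ γ n m * ζ ^ m)) =O[𝓝[≠] 0]
      (fun ζ => ζ) := by
    have h1 := (Asymptotics.isBigO_refl (fun ζ : ℂ => ζ⁻¹ ^ n) (𝓝[≠] 0)).norm_right.mul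
      (hO.mono nhdsWithin_le_nhds)
    refine (h1.congr_left fun ζ => ?_).trans ?_
    · simp [FormalMultilinearSeries.partialSum, laurentCoeffPow, mul_comm]
    · refine Asymptotics.IsBigO.of_bound 1 ?_
      filter_upwards [self_mem_nhdsWithin] with ζ hζ
      have : ‖ζ‖ ≠ 0 := by simpa using hζ
      simp only [norm_mul, norm_pow, norm_inv, norm_norm, one_mul]
      rw [pow_succ, ← mul_assoc, ← mul_pow, inv_mul_cancel₀ this, one_pow, one_mul]
  have h0 : Tendsto (fun ζ : ℂ => ζ) (𝓝[≠] 0) (𝓝 0) := nhdsWithin_le_nhds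
  have h3 := (hO2.trans_tendsto h0).comp tendsto_inv₀_cobounded'
  refine h3.congr' ?_
  filter_upwards [Bornology.eventually_ne_cobounded (0 : ℂ)] with z hz
  simp only [Function.comp, inv_inv, powAtInfty, inv_eq_zero, hz, if_false, faberPoly,
    Polynomial.eval_finsetSum, Polynomial.eval_monomial, mul_sub, Finset.mul_sum]
  congr 1
  · rw [mul_pow, ← mul_assoc, ← mul_pow, mul_inv_cancel₀ hz, one_pow, one_mul]
  · refine Finset.sum_congr rfl fun m hm => ?_
    have : m ≤ n := by grind
    rw [pow_sub₀ z hz this, inv_pow]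
    ring

end IsExteriorRiemannMap

/-! ### Logarithms of double power series on the bidisk -/

/-- If `f` is a nowhere vanishing holomorphic function on the unit disk with `f 0 = 1`, then
`f = exp Λ`, where the coefficients of `Λ` are those of `f' / f`, integrated. -/
theorem exists_log_series {f : ℂ → ℂ} {R : ℝ} (hR : 0 < R)
    (hf : DifferentiableOn ℂ f (Metric.ball 0 R))
    (h0 : f 0 = 1) (hne : ∀ t, ‖t‖ < R → f t ≠ 0) {c : ℕ → ℂ}
    (hc : HasSeriesOn R (fun t => deriv f t / f t) c) {t : ℂ} (ht : ‖t‖ < R) :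
    ∃ L, HasSum (fun n => c n / (n + 1) * t ^ (n + 1)) L ∧ Complex.exp L = f t := by
  -- `g` is a primitive of `f'/f`; below, `f exp(-(g - g 0))` has zero derivative, hence equals its
  -- value `1` at the origin.
  obtain ⟨g, hg⟩ := hc.differentiableOn.isExactOn_ball
  have hg' : ∀ z, ‖z‖ < R → HasDerivAt g (deriv f z / f z) z := fun z hz => hg z (by simpa using hz)
  have hgd : DifferentiableOn ℂ (fun z => g z - g 0) (Metric.ball 0 R) := fun z hz =>
    ((hg' z (by simpa using hz)).sub_const _).differentiableAt.differentiableWithinAt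
  have hser := hgd.hasSeriesOn
  have hderiv := (hser.deriv.congr (g := fun t => deriv f t / f t)
    fun s hs => ((hg' s hs).sub_const _).deriv).unique hc hR
  have hz := hser.of_succ (by simp) ht
  refine ⟨g t - g 0, ?_, ?_⟩
  · refine hz.congr_fun fun n => ?_
    rw [← congrFun hderiv n]
    have : (n : ℂ) + 1 ≠ 0 := by exact_mod_cast n.succ_ne_zero
    field_simp
  · have hd : ∀ z ∈ Metric.ball (0 : ℂ) R,
        HasDerivAt (fun z => f z * Complex.exp (-(g z - g 0))) 0 z := by
      intro z hz
      have hz' : ‖z‖ < R := by simpa using hz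
      have h1 := (hf.differentiableAt (Metric.isOpen_ball.mem_nhds hz)).hasDerivAt
      have h2 := ((hg' z hz').sub_const (g 0)).neg.cexp
      refine (h1.mul h2).congr_deriv ?_
      have := hne z hz'
      field_simp
      ring
    have hconst := Metric.isOpen_ball.is_const_of_deriv_eq_zero
      (convex_ball (0 : ℂ) R).isPreconnected
      (fun z hz => (hd z hz).differentiableAt.differentiableWithinAt)
      (fun z hz => (hd z hz).deriv) (show t ∈ Metric.ball 0 R by simpa using ht)
      (Metric.mem_ball_self hR)
    simp only [sub_self, neg_zero, Complex.exp_zero, h0, mul_one, Complex.exp_neg] at hconst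
    have := Complex.exp_ne_zero (g t - g 0)
    field_simp at hconst
    exact hconst.symm

section Bidisk

variable {κ : ℕ × ℕ → ℂ}

/-- `1 + ∑ κ_{j,i} s^{i+1} t^{j+1}`. -/
noncomputable def bidiskSum (κ : ℕ × ℕ → ℂ) (s t : ℂ) : ℂ :=
  1 + ∑' p : ℕ × ℕ, κ p * s ^ (p.2 + 1) * t ^ (p.1 + 1)

/-- Absolute convergence on all closed bidisks inside the open unit bidisk. -/
def BidiskSummable (κ : ℕ × ℕ → ℂ) : Prop :=
  ∀ r : ℝ, 0 ≤ r → r < 1 → Summable fun p : ℕ × ℕ => ‖κ p‖ * r ^ (p.2 + 1) * r ^ (p.1 + 1)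

theorem BidiskSummable.norm_le {s t : ℂ} {r : ℝ} (hs : ‖s‖ ≤ r) (ht : ‖t‖ ≤ r) (p : ℕ × ℕ) :
    ‖κ p * s ^ (p.2 + 1) * t ^ (p.1 + 1)‖ ≤ ‖κ p‖ * r ^ (p.2 + 1) * r ^ (p.1 + 1) := by
  have := (norm_nonneg s).trans hs
  rw [norm_mul, norm_mul, norm_pow, norm_pow]
  gcongr

theorem BidiskSummable.summable (hκ : BidiskSummable κ) {s t : ℂ} (hs : ‖s‖ < 1) (ht : ‖t‖ < 1) :
    Summable fun p : ℕ × ℕ => κ p * s ^ (p.2 + 1) * t ^ (p.1 + 1) :=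
  Summable.of_norm_bounded (hκ (max ‖s‖ ‖t‖) (by positivity) (max_lt hs ht))
    (norm_le (le_max_left _ _) (le_max_right _ _))

/-- The bound at a radius `r'` strictly between `r` and `1` dominates the series by a product of two
geometric series of ratio `r / r'`. -/
theorem bidiskSummable_of_norm_le (h : ∀ r : ℝ, 0 < r → r < 1 → ∃ M, ∀ p : ℕ × ℕ,
    ‖κ p‖ ≤ M / r ^ p.1 / r ^ p.2) : BidiskSummable κ := by
  intro r hr0 hr1
  obtain ⟨r', hr', hr'1⟩ := exists_between hr1
  have hr'0 := hr0.trans_lt hr'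
  obtain ⟨M, hM⟩ := h r' hr'0 hr'1
  have hq : r / r' < 1 := (div_lt_one hr'0).2 hr'
  have hg := summable_geometric_of_lt_one (by positivity : 0 ≤ r / r') hq
  have hgg := (hg.mul_of_nonneg hg (fun n => by positivity) (fun n => by positivity)).mul_left
    (M * r * r)
  refine Summable.of_nonneg_of_le (fun p => by positivity) (fun p => ?_) hgg
  calc ‖κ p‖ * r ^ (p.2 + 1) * r ^ (p.1 + 1)
      ≤ (M / r' ^ p.1 / r' ^ p.2) * r ^ (p.2 + 1) * r ^ (p.1 + 1) := by gcongr; exact hM p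
    _ = _ := by rw [div_pow, div_pow]; field_simp; ring

theorem BidiskSummable.continuousOn (hκ : BidiskSummable κ) {r : ℝ} (hr : r < 1) :
    ContinuousOn (fun q : ℂ × ℂ => bidiskSum κ q.1 q.2)
      (Metric.closedBall 0 r ×ˢ Metric.closedBall 0 r) := by
  rcases lt_or_ge r 0 with h | h
  · rw [Metric.closedBall_eq_empty.2 h, empty_prod]
    exact continuousOn_empty _
  refine continuousOn_const.add (continuousOn_tsum (fun p => by fun_prop) (hκ r h hr) ?_)
  intro p q hq
  exact norm_le (by simpa using hq.1) (by simpa using hq.2) p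

theorem BidiskSummable.hasSeriesOn_coeff (hκ : BidiskSummable κ) (j : ℕ) :
    HasSeriesOn 1 (fun s => ∑' i, κ (j, i) * s ^ (i + 1))
      (fun n => if n = 0 then 0 else κ (j, n - 1)) := by
  refine hasSeriesOn_succ (a := fun i => κ (j, i)) fun s hs => Summable.hasSum ?_
  -- Any nonzero `t` in the disk serves to isolate the coefficient of `t^(j+1)`; here `t = 1/2`.
  have h2 := (hκ.summable hs (t := 1 / 2) (by norm_num)).prod_factor j
  refine (h2.mul_right ((1 / 2 : ℂ) ^ (j + 1))⁻¹).congr fun i => ?_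
  field_simp

theorem BidiskSummable.hasSeriesOn (hκ : BidiskSummable κ) {s : ℂ} (hs : ‖s‖ < 1) :
    HasSeriesOn 1 (bidiskSum κ s)
      (fun n => if n = 0 then 1 else ∑' i, κ (n - 1, i) * s ^ (i + 1)) := by
  intro t ht
  have h1 := (hκ.summable hs ht).hasSum.prod_fiberwise
    fun j => ((hκ.summable hs ht).prod_factor j).hasSum
  have h2 := (hasSum_nat_add_iff (f := fun n => (if n = 0 then 1 else
    ∑' i, κ (n - 1, i) * s ^ (i + 1)) * t ^ n) 1
    (g := ∑' p : ℕ × ℕ, κ p * s ^ (p.2 + 1) * t ^ (p.1 + 1))).1 (by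
      simpa [tsum_mul_right] using h1)
  rw [bidiskSum, add_comm]
  simpa using h2

/-- Compactness bounds the sum on the bidisk of a larger radius `r'`, and its inverse on that of
radius `r`. Cauchy's estimate on circles of radius `r' - r` turns the former into a bound for the
`t`-derivative, uniform in `s`. -/
theorem BidiskSummable.exists_logDeriv_bound (hκ : BidiskSummable κ)
    (hne : ∀ s t, ‖s‖ < 1 → ‖t‖ < 1 → bidiskSum κ s t ≠ 0) {r : ℝ} (hr1 : r < 1) :
    ∃ M, ∀ s t, ‖s‖ ≤ r → ‖t‖ ≤ r → ‖deriv (bidiskSum κ s) t / bidiskSum κ s t‖ ≤ M := by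
  obtain ⟨r', hr', hr'1⟩ := exists_between hr1
  have hcomp : ∀ ρ : ℝ, IsCompact (Metric.closedBall (0 : ℂ) ρ ×ˢ Metric.closedBall (0 : ℂ) ρ) :=
    fun ρ => (isCompact_closedBall 0 ρ).prod (isCompact_closedBall 0 ρ)
  obtain ⟨M1, hM1⟩ := (hcomp r').exists_bound_of_continuousOn (hκ.continuousOn hr'1)
  obtain ⟨M2, hM2⟩ := (hcomp r).exists_bound_of_continuousOn
    ((hκ.continuousOn hr1).inv₀ fun q hq => hne _ _
      ((mem_closedBall_zero_iff.1 hq.1).trans_lt hr1) ((mem_closedBall_zero_iff.1 hq.2).trans_lt hr1))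
  refine ⟨M1 / (r' - r) * M2, fun s t hs ht => ?_⟩
  rw [div_eq_mul_inv, norm_mul]
  have hd : ‖deriv (bidiskSum κ s) t‖ ≤ M1 / (r' - r) := by
    have hsub : Metric.closedBall t (r' - r) ⊆ Metric.ball 0 1 := by
      intro z hz
      rw [mem_closedBall_iff_norm] at hz
      rw [mem_ball_zero_iff]
      have := norm_le_norm_add_norm_sub' z t
      linarith
    refine Complex.norm_deriv_le_of_forall_mem_sphere_norm_le (by linarith) ?_ ?_
    · refine DifferentiableOn.diffContOnCl ?_
      rw [closure_ball _ (by linarith)]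
      exact (hκ.hasSeriesOn (hs.trans_lt hr1)).differentiableOn.mono hsub
    · intro z hz
      rw [mem_sphere_iff_norm] at hz
      have := norm_le_norm_add_norm_sub' z t
      exact hM1 (s, z) ⟨by simpa using hs.trans hr'.le, by simp; linarith⟩
  have h2 := hM2 (s, t) ⟨by simpa using hs, by simpa using ht⟩
  exact mul_le_mul hd h2 (norm_nonneg _) ((norm_nonneg _).trans hd)

/-- A nowhere vanishing double power series on the bidisk which equals `1` on both axes is the
exponential of such a series. -/
theorem BidiskSummable.exists_log (hκ : BidiskSummable κ)
    (hne : ∀ s t, ‖s‖ < 1 → ‖t‖ < 1 → bidiskSum κ s t ≠ 0) :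
    ∃ e : ℕ × ℕ → ℂ, ∀ s t : ℂ, ‖s‖ < 1 → ‖t‖ < 1 →
      ∃ L, HasSum (fun p : ℕ × ℕ => e p * s ^ (p.2 + 1) * t ^ (p.1 + 1)) L ∧
        Complex.exp L = bidiskSum κ s t := by
  set J : ℂ → ℂ → ℂ := fun s t => deriv (bidiskSum κ s) t / bidiskSum κ s t with hJ
  set c : ℂ → ℕ → ℂ := fun s n => iteratedDeriv n (J s) 0 / (n.factorial : ℂ) with hc
  have hcs : ∀ s : ℂ, ‖s‖ < 1 → HasSeriesOn 1 (J s) (c s) := by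
    intro s hs
    refine DifferentiableOn.hasSeriesOn ?_
    have hd := (hκ.hasSeriesOn hs).differentiableOn
    exact (hd.deriv Metric.isOpen_ball).div hd fun t ht => hne s t hs (by simpa using ht)
  -- Comparing coefficients in `∂_t K = K J` expresses `c s n` through power series in `s` and
  -- earlier coefficients. So each `c s n` is holomorphic in `s` and vanishes at `s = 0`, with no
  -- appeal to several complex variables.
  have hrec : ∀ (s : ℂ), ‖s‖ < 1 → ∀ n, c s n = (n + 1) * (∑' i, κ (n, i) * s ^ (i + 1)) -
      ∑ k ∈ Finset.range n, (∑' i, κ (n - k - 1, i) * s ^ (i + 1)) * c s k := by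
    intro s hs n
    rw [coeff_of_deriv_eq_mul one_pos (hκ.hasSeriesOn hs) (hcs s hs) (by simp)
      (fun t ht => by simp only [hJ]; field_simp [hne s t hs ht])]
    simp only [Nat.add_eq_zero_iff, one_ne_zero, and_false, if_false, Nat.add_sub_cancel]
    congr 1
    refine Finset.sum_congr rfl fun k hk => ?_
    have : n - k ≠ 0 := by grind
    simp [this]
  have hcoef : ∀ n, DifferentiableOn ℂ (fun s => c s n) (Metric.ball 0 1) ∧ c 0 n = 0 := by
    intro n
    induction n using Nat.strong_induction_on with
    | _ n ih =>
      constructor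
      · refine DifferentiableOn.congr (f := fun s => (n + 1) * (∑' i, κ (n, i) * s ^ (i + 1)) -
          ∑ k ∈ Finset.range n, (∑' i, κ (n - k - 1, i) * s ^ (i + 1)) * c s k) ?_
          fun s hs => hrec s (by simpa using hs) n
        refine ((hκ.hasSeriesOn_coeff n).differentiableOn.const_mul _).sub
          (DifferentiableOn.fun_sum fun k hk => ?_)
        exact (hκ.hasSeriesOn_coeff _).differentiableOn.mul (ih k (Finset.mem_range.1 hk)).1
      · rw [hrec 0 (by simp)]
        simp
  -- Taylor coefficients in `s` of `c s n`; the division by `n + 1` is the integration in `t`.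
  set e : ℕ × ℕ → ℂ := fun p =>
    iteratedDeriv (p.2 + 1) (fun s => c s p.1) 0 / ((p.2 + 1).factorial : ℂ) / (p.1 + 1) with he
  have hes : ∀ n, ∀ s : ℂ, ‖s‖ < 1 →
      HasSum (fun i => e (n, i) * s ^ (i + 1)) (c s n / (n + 1)) := by
    intro n s hs
    have := ((hcoef n).1.hasSeriesOn.of_succ (by simp [(hcoef n).2]) hs).div_const ((n : ℂ) + 1)
    refine this.congr_fun fun i => ?_
    simp only [he]
    ring
  -- Cauchy's estimate is applied twice, first in `t` uniformly in `s`, then in `s`.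
  have hesum : BidiskSummable e := by
    refine bidiskSummable_of_norm_le fun r hr0 hr1 => ?_
    obtain ⟨M, hM⟩ := hκ.exists_logDeriv_bound hne hr1
    refine ⟨M / r, fun p => ?_⟩
    have h1 : ∀ s : ℂ, ‖s‖ = r → ‖c s p.1‖ ≤ M / r ^ p.1 := fun s hs =>
      (hcs s (hs.trans_lt hr1)).norm_coeff_le hr0 hr1 (fun t ht => hM s t hs.le ht.le) p.1
    have h2 := (hcoef p.1).1.hasSeriesOn.norm_coeff_le hr0 hr1 h1 (p.2 + 1)
    have h3 : (1 : ℝ) ≤ ‖(p.1 : ℂ) + 1‖ := by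
      rw [← Nat.cast_succ, Complex.norm_natCast]
      exact_mod_cast Nat.succ_le_succ p.1.zero_le
    calc ‖e p‖ ≤ ‖iteratedDeriv (p.2 + 1) (fun s => c s p.1) 0 / ((p.2 + 1).factorial : ℂ)‖ := by
          rw [he, norm_div]
          exact div_le_self (norm_nonneg _) h3
      _ ≤ _ := h2
      _ = _ := by rw [pow_succ]; field_simp
  refine ⟨e, fun s t hs ht => ?_⟩
  obtain ⟨L, hL, hexp⟩ := exists_log_series one_pos (hκ.hasSeriesOn hs).differentiableOn
    (by simpa using (hκ.hasSeriesOn hs).apply_zero one_pos) (fun t ht => hne s t hs ht)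
    (hcs s hs) ht
  refine ⟨L, ?_, hexp⟩
  have h1 := (hesum.summable hs ht).hasSum
  have h2 := h1.prod_fiberwise (g := fun n => c s n / (n + 1) * t ^ (n + 1))
    fun n => (hes n s hs).mul_right (t ^ (n + 1))
  rwa [h2.unique hL] at h1

end Bidisk

/-! ### Divided differences of a power series -/

section DividedDifference

variable {h : ℂ → ℂ} {η : ℕ → ℂ}

/-- Since `(s^(n+1) - t^(n+1)) / (s - t) = ∑ s^k t^(n-k)`, the coefficients `-η_{i+j+1}` belong to
`-s t (h(s) - h(t)) / (s - t)`. Cauchy's estimate for `η` gives convergence. -/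
theorem HasSeriesOn.bidiskSummable (hh : HasSeriesOn 1 h η) :
    BidiskSummable fun p => -η (p.2 + p.1 + 1) := by
  refine bidiskSummable_of_norm_le fun r hr0 hr1 => ?_
  have hsph : Metric.sphere (0 : ℂ) r ⊆ Metric.ball 0 1 := fun z hz => by
    rw [mem_ball_zero_iff, mem_sphere_zero_iff_norm.1 hz]
    exact hr1
  obtain ⟨M, hM⟩ := (isCompact_sphere (0 : ℂ) r).exists_bound_of_continuousOn
    (hh.differentiableOn.continuousOn.mono hsph)
  refine ⟨M / r, fun p => ?_⟩
  rw [norm_neg]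
  refine (hh.norm_coeff_le hr0 hr1 (fun s hs => hM s (by simpa using hs)) _).trans_eq ?_
  rw [pow_add, pow_add]
  field_simp

/-- The coefficients depend on `i + j` only, so the absolutely convergent double series is grouped
along antidiagonals. -/
theorem HasSeriesOn.hasSum_bidiskSum (hh : HasSeriesOn 1 h η) {s t : ℂ} (hs : ‖s‖ < 1)
    (ht : ‖t‖ < 1) :
    HasSum (fun n => -η (n + 1) * (s * t) * ∑ k ∈ Finset.range (n + 1), s ^ k * t ^ (n - k))
      (bidiskSum (fun p => -η (p.2 + p.1 + 1)) s t - 1) := by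
  have h1 := (hh.bidiskSummable.summable hs ht).hasSum
  rw [bidiskSum, add_sub_cancel_left]
  rw [← (Equiv.prodComm ℕ ℕ).hasSum_iff, ← Finset.HasAntidiagonal.sigmaAntidiagonalEquivProd.hasSum_iff] at h1
  refine (h1.sigma fun n => hasSum_fintype _).congr_fun fun n => ?_
  refine Eq.trans ?_ (Finset.sum_attach (Finset.HasAntidiagonal.antidiagonal n)
    (fun p => -η (p.1 + p.2 + 1) * s ^ (p.1 + 1) * t ^ (p.2 + 1))).symm
  rw [Finset.Nat.sum_antidiagonal_eq_sum_range_succ_mk, Finset.mul_sum]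
  refine Finset.sum_congr rfl fun k hk => ?_
  have : k + (n - k) = n := by grind
  rw [this]
  ring

theorem HasSeriesOn.sub_mul_bidiskSum (hh : HasSeriesOn 1 h η) {s t : ℂ} (hs : ‖s‖ < 1)
    (ht : ‖t‖ < 1) :
    (s - t) * (bidiskSum (fun p => -η (p.2 + p.1 + 1)) s t - 1) = -(s * t) * (h s - h t) := by
  have h1 := (hh.hasSum_bidiskSum hs ht).mul_left (s - t)
  have h2 := (((hasSum_nat_add_iff' 1).2 (hh s hs)).sub
    ((hasSum_nat_add_iff' 1).2 (hh t ht))).mul_left (-(s * t))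
  simp only [Finset.range_one, Finset.sum_singleton, pow_zero, mul_one, sub_sub_sub_cancel_right]
    at h2
  refine h1.unique (h2.congr_fun fun n => ?_)
  have hg := (Commute.all s t).mul_geom_sum₂ (n + 1)
  simp only [Nat.add_sub_cancel] at hg
  calc _ = -η (n + 1) * (s * t) *
        ((s - t) * ∑ k ∈ Finset.range (n + 1), s ^ k * t ^ (n - k)) := by ring
    _ = _ := by rw [hg]; ring

/-- On the diagonal the inner sum is `(n+1) s^n`, which turns the divided difference into the
derivative. -/
theorem HasSeriesOn.bidiskSum_self (hh : HasSeriesOn 1 h η) {s : ℂ} (hs : ‖s‖ < 1) :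
    bidiskSum (fun p => -η (p.2 + p.1 + 1)) s s - 1 = -(s * s) * _root_.deriv h s := by
  refine (hh.hasSum_bidiskSum hs hs).unique
    (((hh.deriv s hs).mul_left (-(s * s))).congr_fun fun n => ?_)
  have : ∑ k ∈ Finset.range (n + 1), s ^ k * s ^ (n - k) = (n + 1) * s ^ n := by
    rw [Finset.sum_congr rfl fun k hk => ?_, Finset.sum_const, Finset.card_range, nsmul_eq_mul,
      Nat.cast_succ]
    rw [← pow_add]
    congr 1
    grind
  rw [this]
  ring

end DividedDifference

/-! ### Existence, uniqueness and symmetry of the Grunsky coefficients -/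

namespace IsExteriorRiemannMap

variable {G : Set ℂ} {φ : ℂ → ℂ} {γ : ℝ}

/-- After inversion of both variables the quotient is the bidisk sum with coefficients `-η_{i+j+1}`,
and only its zero-freeness is at stake. On the axes it is `1`, off the diagonal it is nonzero by
injectivity of `ψ`, and at `s = t ≠ 0` it equals `γ ψ'(1/s) ≠ 0`. -/
theorem exists_isGrunskyCoeffs (hφ : IsExteriorRiemannMap G φ γ) (hG : Bornology.IsBounded G) :
    ∃ b, IsGrunskyCoeffs (exteriorInverse G φ) γ b := by
  obtain ⟨h, hd, hψ⟩ := hφ.exists_inverse_eq hG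
  set ψ := exteriorInverse G φ with hψdef
  have hγ : (γ : ℂ) ≠ 0 := by exact_mod_cast hφ.pos.ne'
  have hh := hd.hasSeriesOn
  set η : ℕ → ℂ := fun n => iteratedDeriv n h 0 / (n.factorial : ℂ)
  have hK : ∀ s t : ℂ, s ≠ 0 → t ≠ 0 → ‖s‖ < 1 → ‖t‖ < 1 → s ≠ t →
      bidiskSum (fun p => -η (p.2 + p.1 + 1)) s t =
        (ψ s⁻¹ - ψ t⁻¹) / ((γ : ℂ)⁻¹ * (s⁻¹ - t⁻¹)) := by
    intro s t hs0 ht0 hs ht hne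
    have h1 := hh.sub_mul_bidiskSum hs ht
    have h2 : γ * (ψ s⁻¹ - ψ t⁻¹) = s⁻¹ - t⁻¹ + (h s - h t) := by
      rw [mul_sub, hψ s hs0 hs, hψ t ht0 ht]
      ring
    have h3 : s - t ≠ 0 := sub_ne_zero.2 hne
    have h4 : s⁻¹ - t⁻¹ = -(s - t) / (s * t) := by field_simp; ring
    have h5 : (γ : ℂ)⁻¹ * (s⁻¹ - t⁻¹) ≠ 0 :=
      mul_ne_zero (inv_ne_zero hγ) (sub_ne_zero.2 fun h => hne (inv_injective h))
    rw [eq_div_iff h5]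
    have h6 : ψ s⁻¹ - ψ t⁻¹ = (γ : ℂ)⁻¹ * (s⁻¹ - t⁻¹ + (h s - h t)) := by
      rw [← h2]
      field_simp
    rw [h6, h4]
    field_simp
    linear_combination (-1) * h1
  have hne : ∀ s t, ‖s‖ < 1 → ‖t‖ < 1 → bidiskSum (fun p => -η (p.2 + p.1 + 1)) s t ≠ 0 := by
    intro s t hs ht
    by_cases hs0 : s = 0
    · simp [bidiskSum, hs0]
    by_cases ht0 : t = 0
    · simp [bidiskSum, ht0]
    by_cases hst : s = t
    · subst hst
      have h1 : HasDerivAt (fun s : ℂ => γ * ψ s⁻¹) (γ * (deriv ψ s⁻¹ * -(s ^ 2)⁻¹)) s :=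
        ((hφ.hasDerivAt_inverse (inv_mem_exteriorDisk hs0 hs)).differentiableAt.hasDerivAt.comp s
          (hasDerivAt_inv hs0)).const_mul _
      have h2 : HasDerivAt (fun s : ℂ => s⁻¹ + h s) (-(s ^ 2)⁻¹ + deriv h s) s :=
        (hasDerivAt_inv hs0).add (hh.differentiableAt hs).hasDerivAt
      have h3 := h1.unique (h2.congr_of_eventuallyEq (by
        filter_upwards [isOpen_ne.mem_nhds hs0, Metric.isOpen_ball.mem_nhds
          (mem_ball_zero_iff.2 hs)] with x hx hx1
        exact hψ x hx (by simpa using hx1)))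
      have h4 : bidiskSum (fun p => -η (p.2 + p.1 + 1)) s s = γ * deriv ψ s⁻¹ := by
        have := hh.bidiskSum_self hs
        field_simp at h3
        rw [one_div] at h3
        linear_combination this + h3
      rw [h4]
      exact mul_ne_zero hγ (hφ.deriv_inverse_ne_zero (inv_mem_exteriorDisk hs0 hs))
    · rw [hK s t hs0 ht0 hs ht hst]
      refine div_ne_zero (sub_ne_zero.2 fun h => hst ?_)
        (mul_ne_zero (inv_ne_zero hγ) (sub_ne_zero.2 fun h => hst (inv_injective h)))
      exact inv_injective (hφ.injOn_inverse (inv_mem_exteriorDisk hs0 hs)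
        (inv_mem_exteriorDisk ht0 ht) h)
  obtain ⟨e, he⟩ := hh.bidiskSummable.exists_log hne
  -- The series `e` expands the logarithm itself, whereas Grunsky coefficients carry a minus sign
  -- and indices starting at `1`.
  refine ⟨fun n l => -e (n - 1, l - 1), fun w hw v hv => ?_⟩
  obtain ⟨L, hL, hexp⟩ := he w⁻¹ v⁻¹ (norm_inv_lt_one hw) (norm_inv_lt_one hv)
  simp only [Nat.add_sub_cancel, Prod.mk.eta, neg_mul]
  refine ⟨hL.neg.summable, fun hne => ?_⟩
  rw [tsum_neg, neg_neg, hL.tsum_eq, hexp, hK _ _ (inv_ne_zero (ne_zero_of_mem_exteriorDisk hw))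
    (inv_ne_zero (ne_zero_of_mem_exteriorDisk hv)) (norm_inv_lt_one hw) (norm_inv_lt_one hv)
    (fun h => hne (inv_injective h)), inv_inv, inv_inv]

theorem isGrunskyCoeffs (hφ : IsExteriorRiemannMap G φ γ) (hG : Bornology.IsBounded G) :
    IsGrunskyCoeffs (exteriorInverse G φ) γ (grunskyCoeff G φ γ) :=
  Classical.epsilon_spec (hφ.exists_isGrunskyCoeffs hG)

end IsExteriorRiemannMap

namespace IsGrunskyCoeffs

variable {ψ : ℂ → ℂ} {γ : ℝ} {b b' : ℕ → ℕ → ℂ}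

theorem bidiskSummable (hb : IsGrunskyCoeffs ψ γ b) :
    BidiskSummable fun p => b (p.1 + 1) (p.2 + 1) := by
  intro r hr0 hr1
  rcases hr0.eq_or_lt with rfl | hr0
  · simp
  have hr : ((r⁻¹ : ℝ) : ℂ) ∈ exteriorDisk := by
    have := (one_lt_inv₀ hr0).2 hr1
    simpa [exteriorDisk, abs_of_pos hr0] using this
  simpa [abs_of_pos hr0] using (hb _ hr _ hr).1.norm

/-- The defining identity excludes the diagonal. Requiring `‖t‖ < ‖w⁻¹‖` keeps `1/t` off `w`,
leaving a full punctured disk in `t`. -/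
theorem exp_eq (hb : IsGrunskyCoeffs ψ γ b) {w t : ℂ} (hw : w ∈ exteriorDisk) (ht0 : t ≠ 0)
    (ht : ‖t‖ < ‖w⁻¹‖) :
    Complex.exp (-(bidiskSum (fun p => b (p.1 + 1) (p.2 + 1)) w⁻¹ t - 1)) =
      (ψ w - ψ t⁻¹) / ((γ : ℂ)⁻¹ * (w - t⁻¹)) := by
  have hv := inv_mem_exteriorDisk ht0 (ht.trans (norm_inv_lt_one hw))
  have hne : w ≠ t⁻¹ := by
    rintro rfl
    simp at ht
  rw [← (hb w hw _ hv).2 hne, bidiskSum, add_sub_cancel_left, inv_inv]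

/-- For fixed `s = 1/w` two expansions differ by a function `E` of `t` with `exp E = 1` near `0`, so
`E' = 0` and their `t`-coefficients agree. These are power series in `s`, whose coefficients then
agree as well. -/
theorem unique (hb : IsGrunskyCoeffs ψ γ b) (hb' : IsGrunskyCoeffs ψ γ b') (n l : ℕ) :
    b (n + 1) (l + 1) = b' (n + 1) (l + 1) := by
  have key : ∀ s : ℂ, ‖s‖ < 1 → ∑' i, b (n + 1) (i + 1) * s ^ (i + 1) =
      ∑' i, b' (n + 1) (i + 1) * s ^ (i + 1) := by
    intro s hs
    rcases eq_or_ne s 0 with rfl | hs0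
    · simp
    have hw := inv_mem_exteriorDisk hs0 hs
    have hpos := norm_pos_iff.2 hs0
    have h1 := (hb.bidiskSummable.hasSeriesOn hs).mono hs.le
    have h2 := (hb'.bidiskSummable.hasSeriesOn hs).mono hs.le
    have hE := h1.sub h2
    set E : ℂ → ℂ := fun t => bidiskSum (fun p => b (p.1 + 1) (p.2 + 1)) s t -
      bidiskSum (fun p => b' (p.1 + 1) (p.2 + 1)) s t with hEdef
    have hexp : ∀ t, ‖t‖ < ‖s‖ → Complex.exp (E t) = 1 := by
      intro t ht
      rcases eq_or_ne t 0 with rfl | ht0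
      · simp [hEdef, bidiskSum]
      have e1 := hb.exp_eq hw ht0 (by rwa [inv_inv])
      have e2 := hb'.exp_eq hw ht0 (by rwa [inv_inv])
      rw [← e2, inv_inv] at e1
      have : E t = -(bidiskSum (fun p => b' (p.1 + 1) (p.2 + 1)) s t - 1) -
        (-(bidiskSum (fun p => b (p.1 + 1) (p.2 + 1)) s t - 1)) := by simp only [hEdef]; ring
      rw [this, Complex.exp_sub, e1, div_self (Complex.exp_ne_zero _)]
    have hzero : ∀ t, ‖t‖ < ‖s‖ → deriv E t = 0 := by
      intro t ht
      have hd := (hE.differentiableAt ht).hasDerivAt.cexp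
      have hc : HasDerivAt (fun t => Complex.exp (E t)) 0 t := by
        refine (hasDerivAt_const t (1 : ℂ)).congr_of_eventuallyEq ?_
        filter_upwards [Metric.isOpen_ball.mem_nhds (mem_ball_zero_iff.2 ht)] with x hx
        exact hexp x (mem_ball_zero_iff.1 hx)
      have := hd.unique hc
      rwa [hexp t ht, one_mul] at this
    have hser : HasSeriesOn ‖s‖ (deriv E) 0 := fun t ht => by simp [hzero t ht, hasSum_zero]
    have := congrFun (hE.deriv.unique hser hpos) n
    have hn : (n : ℂ) + 1 ≠ 0 := by exact_mod_cast n.succ_ne_zero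
    simpa [hn, sub_eq_zero] using this
  have h1 := hb.bidiskSummable.hasSeriesOn_coeff n
  have h2 := hb'.bidiskSummable.hasSeriesOn_coeff n
  have := congrFun ((h1.congr key).unique h2 one_pos) (l + 1)
  simpa using this

/-- The quotient `(ψ(w) - ψ(v)) / (w - v)` is invariant under exchanging `w` and `v`. With
uniqueness this makes the Grunsky matrix symmetric. -/
theorem symm (hb : IsGrunskyCoeffs ψ γ b) : IsGrunskyCoeffs ψ γ fun n l => b l n := by
  intro w hw v hv
  obtain ⟨h1, h2⟩ := hb v hv w hw
  have hs : ∀ p : ℕ × ℕ, b (p.2 + 1) (p.1 + 1) * w⁻¹ ^ (p.2 + 1) * v⁻¹ ^ (p.1 + 1) =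
      (fun p : ℕ × ℕ => b (p.1 + 1) (p.2 + 1) * v⁻¹ ^ (p.2 + 1) * w⁻¹ ^ (p.1 + 1))
        (Equiv.prodComm ℕ ℕ p) := fun p => by simp; ring
  simp only [hs]
  refine ⟨(Equiv.prodComm ℕ ℕ).summable_iff.2 h1, fun hne => ?_⟩
  rw [(Equiv.prodComm ℕ ℕ).tsum_eq
    (fun p : ℕ × ℕ => b (p.1 + 1) (p.2 + 1) * v⁻¹ ^ (p.2 + 1) * w⁻¹ ^ (p.1 + 1)), h2 hne.symm,
    ← neg_sub (ψ w), ← neg_sub w, mul_neg, neg_div_neg_eq]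

theorem coeff_comm (hb : IsGrunskyCoeffs ψ γ b) (n l : ℕ) :
    b (n + 1) (l + 1) = b (l + 1) (n + 1) :=
  hb.unique hb.symm n l

end IsGrunskyCoeffs

/-! ### Faber polynomials and Grunsky coefficients -/

/-- A nonconstant polynomial is unbounded along `F → ∞`, and a constant one equals its limit. -/
theorem eq_zero_of_tendsto_eval_zero {F : ℂ → ℂ} {Q : Polynomial ℂ}
    (hF : Tendsto F (Bornology.cobounded ℂ) (Bornology.cobounded ℂ))
    (hQ : Tendsto (fun w => Q.eval (F w)) (Bornology.cobounded ℂ) (𝓝 0)) : Q = 0 := by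
  by_cases hdeg : 0 < Q.degree
  · have h1 := Polynomial.tendsto_norm_atTop Q hdeg
      (tendsto_norm_cobounded_atTop.comp hF)
    exact absurd h1 (not_tendsto_atTop_of_tendsto_nhds (by simpa using hQ.norm))
  · rw [Polynomial.eq_C_of_degree_le_zero (not_lt.1 hdeg)] at hQ ⊢
    simp only [Polynomial.eval_C] at hQ
    rw [tendsto_nhds_unique hQ tendsto_const_nhds |>.symm, Polynomial.C_0]

theorem eventually_mem_exteriorDisk : ∀ᶠ w in Bornology.cobounded ℂ, w ∈ exteriorDisk :=
  tendsto_norm_cobounded_atTop.eventually (eventually_gt_atTop 1)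

namespace IsExteriorRiemannMap

variable {G : Set ℂ} {φ : ℂ → ℂ} {γ : ℝ} {b : ℕ → ℕ → ℂ}

/-- The logarithmic derivative in `v⁻¹` of the generating function. -/
theorem deriv_generating (hγ : γ ≠ 0) {ψ h : ℂ → ℂ}
    (hψ : ∀ s : ℂ, s ≠ 0 → ‖s‖ < 1 → γ * ψ s⁻¹ = s⁻¹ + h s)
    (hb : IsGrunskyCoeffs ψ γ b) {w : ℂ} (hw : w ∈ exteriorDisk) {t : ℂ} (ht : ‖t‖ < ‖w⁻¹‖) :
    deriv (fun t => 1 + t * h t - γ * t * ψ w) t = (1 + t * h t - γ * t * ψ w) *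
      -(deriv (bidiskSum (fun p => b (p.1 + 1) (p.2 + 1)) w⁻¹) t + w / (1 - w * t)) := by
  have hγ' : (γ : ℂ) ≠ 0 := by exact_mod_cast hγ
  have hw1 := norm_inv_lt_one hw
  have hw0 := ne_zero_of_mem_exteriorDisk hw
  have hne : ∀ x : ℂ, ‖x‖ < ‖w⁻¹‖ → 1 - w * x ≠ 0 := by
    intro x hx h0
    have : x = w⁻¹ := by
      field_simp
      linear_combination -h0
    rw [this] at hx
    exact lt_irrefl _ hx
  set Λ := bidiskSum (fun p => b (p.1 + 1) (p.2 + 1)) w⁻¹ with hΛ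
  -- Since `1 + x h(x) = γ x ψ(1/x)`, the left side is `γ x (ψ(1/x) - ψ(w))`. The `-1` in the
  -- exponent removes the constant term of `bidiskSum`.
  have hM : ∀ x : ℂ, ‖x‖ < ‖w⁻¹‖ →
      1 + x * h x - γ * x * ψ w = Complex.exp (-(Λ x - 1)) * (1 - w * x) := by
    intro x hx
    rcases eq_or_ne x 0 with rfl | hx0
    · simp [hΛ, bidiskSum]
    · rw [hb.exp_eq hw hx0 hx]
      have h1 := hψ x hx0 (hx.trans hw1)
      have h2 : w - x⁻¹ ≠ 0 := by
        intro h0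
        apply hne x hx
        have : w = x⁻¹ := by linear_combination h0
        rw [this, inv_mul_cancel₀ hx0, sub_self]
      have h3 : 1 - w * x = -x * (w - x⁻¹) := by
        field_simp
        ring
      have h4 : 1 + x * h x = x * (γ * ψ x⁻¹) := by
        rw [h1]
        field_simp
      have h5 : (γ : ℂ)⁻¹ * (w - x⁻¹) ≠ 0 := mul_ne_zero (inv_ne_zero hγ') h2
      rw [h3, h4, div_mul_eq_mul_div, eq_div_iff h5]
      linear_combination (x * (ψ x⁻¹ - ψ w)) * (w - x⁻¹) * mul_inv_cancel₀ hγ'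
  have hΛd : HasDerivAt Λ (deriv Λ t) t :=
    ((hb.bidiskSummable.hasSeriesOn hw1).differentiableAt (ht.trans hw1)).hasDerivAt
  have hd := ((hΛd.sub_const 1).neg.cexp).mul (((hasDerivAt_id t).const_mul w).const_sub 1)
  have hev : (fun t => 1 + t * h t - γ * t * ψ w) =ᶠ[𝓝 t]
      fun x => Complex.exp (-(Λ x - 1)) * (1 - w * x) := by
    filter_upwards [Metric.isOpen_ball.mem_nhds (mem_ball_zero_iff.2 ht)] with x hx
    exact hM x (mem_ball_zero_iff.1 hx)
  rw [hev.deriv_eq, hM t ht]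
  refine hd.deriv.trans ?_
  have := hne t ht
  simp only [Pi.neg_apply, id]
  field_simp
  ring

/-- The function `1 + t h(t) - γ t ψ(w)` has Taylor coefficients in `t` that are polynomials in
`ψ(w)`, with constant term `1`. The Newton-type recurrence for its logarithmic derivative then
produces, by strong induction, polynomials in `ψ(w)`; by `deriv_generating` they are, up to sign,
the right-hand sides here. -/
theorem exists_polynomial (hφ : IsExteriorRiemannMap G φ γ) (hG : Bornology.IsBounded G)
    (hb : IsGrunskyCoeffs (exteriorInverse G φ) γ b) (n : ℕ) :
    ∃ A : Polynomial ℂ, ∀ w ∈ exteriorDisk, A.eval (exteriorInverse G φ w) =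
      (n + 1) * ∑' i, b (n + 1) (i + 1) * w⁻¹ ^ (i + 1) + w ^ (n + 1) := by
  obtain ⟨h, hd, hψ⟩ := hφ.exists_inverse_eq hG
  set ψ := exteriorInverse G φ
  have hh := hd.hasSeriesOn
  set η : ℕ → ℂ := fun n => iteratedDeriv n h 0 / (n.factorial : ℂ)
  -- `-B w n` is the coefficient of `t^n` in the logarithmic derivative: the sum comes from the
  -- Grunsky series, and `w^(n+1)` from `w / (1 - w t)`.
  set B : ℂ → ℕ → ℂ := fun w n =>
    (n + 1) * (∑' i, b (n + 1) (i + 1) * w⁻¹ ^ (i + 1)) + w ^ (n + 1) with hB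
  set m : ℂ → ℕ → ℂ := fun w n =>
    (if n = 0 then 1 else η (n - 1)) - if n = 1 then γ * ψ w else 0 with hm
  have hrec : ∀ w ∈ exteriorDisk, ∀ n, -B w n = (n + 1) * m w (n + 1) -
      ∑ k ∈ Finset.range n, m w (n - k) * -B w k := by
    intro w hw n
    have hw1 := norm_inv_lt_one hw
    have hpos : 0 < ‖w⁻¹‖ := norm_pos_iff.2 (inv_ne_zero (ne_zero_of_mem_exteriorDisk hw))
    have hser1 : HasSeriesOn ‖w⁻¹‖ (fun t => 1 + t * h t - γ * t * ψ w) (m w) := by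
      intro t ht
      have h1 := (hasSum_nat_add_iff (f := fun n => (if n = 0 then 1 else η (n - 1)) * t ^ n) 1
        (g := t * h t)).1 (((hh t (ht.trans hw1)).mul_left t).congr_fun fun n => by
          simp; ring)
      have h2 := h1.sub (hasSum_single (f := fun n => (if n = 1 then γ * ψ w else 0) * t ^ n) 1
        fun n hn => by simp [hn])
      have h3 : 1 + t * h t - γ * t * ψ w = t * h t + ∑ i ∈ Finset.range 1,
          (if i = 0 then 1 else η (i - 1)) * t ^ i - (if 1 = 1 then γ * ψ w else 0) * t ^ 1 := by
        simp
        ring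
      beta_reduce
      rw [h3]
      exact h2.congr_fun fun n => by simp only [hm]; ring
    have hser2 : HasSeriesOn ‖w⁻¹‖
        (fun t => -(deriv (bidiskSum (fun p => b (p.1 + 1) (p.2 + 1)) w⁻¹) t + w / (1 - w * t)))
        (fun n => -B w n) := by
      have h1 := ((hb.bidiskSummable.hasSeriesOn hw1).deriv).mono hw1.le
      have h2 : HasSeriesOn ‖w⁻¹‖ (fun t => w / (1 - w * t)) (fun n => w ^ (n + 1)) := by
        intro t ht
        have : ‖w * t‖ < 1 := by
          have hwpos : 0 < ‖w‖ := zero_lt_one.trans hw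
          rw [norm_inv, ← mul_one ‖w‖⁻¹, lt_inv_mul_iff₀ hwpos] at ht
          rwa [norm_mul]
        refine ((hasSum_geometric_of_norm_lt_one this).mul_left w).congr_fun fun n => ?_
        simp only [mul_pow]
        ring
      simpa [hB] using (h1.add h2).neg
    exact coeff_of_deriv_eq_mul hpos hser1 hser2 (by simp [hm])
      (fun t ht => deriv_generating hφ.pos.ne' hψ hb hw ht) n
  induction n using Nat.strong_induction_on with
  | _ n ih =>
    choose! A hA using ih
    refine ⟨-((n + 1) * (Polynomial.C (η n) - if n = 0 then Polynomial.C (γ : ℂ) * Polynomial.X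
      else 0) + ∑ k ∈ Finset.range n, (Polynomial.C (η (n - k - 1)) - if n - k = 1 then
        Polynomial.C (γ : ℂ) * Polynomial.X else 0) * A k), fun w hw => ?_⟩
    have h1 := hrec w hw n
    change _ = B w n
    rw [← neg_neg (B w n), h1]
    simp only [Polynomial.eval_neg, Polynomial.eval_add, Polynomial.eval_mul, Polynomial.eval_sub,
      Polynomial.eval_natCast, Polynomial.eval_one, Polynomial.eval_C, Polynomial.eval_finsetSum,
      mul_neg, Finset.sum_neg_distrib, sub_neg_eq_add, hm]
    congr 2
    · by_cases h0 : n = 0 <;> simp [h0]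
    · refine Finset.sum_congr rfl fun k hk => ?_
      have hk' := Finset.mem_range.1 hk
      rw [hA k hk' w hw]
      have : n - k ≠ 0 := by omega
      by_cases h0 : n - k = 1 <;> simp [h0, this, hB]

/-- `F_{n+1}(ψ(w)) = w^{n+1} + (n+1) ∑ b_{n+1,l} w⁻ˡ`. -/
theorem faberPoly_eval_inverse (hφ : IsExteriorRiemannMap G φ γ) (hG : Bornology.IsBounded G)
    (hb : IsGrunskyCoeffs (exteriorInverse G φ) γ b) (n : ℕ) {w : ℂ} (hw : w ∈ exteriorDisk) :
    (faberPoly φ γ (n + 1)).eval (exteriorInverse G φ w) =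
      (n + 1) * ∑' i, b (n + 1) (i + 1) * w⁻¹ ^ (i + 1) + w ^ (n + 1) := by
  obtain ⟨A, hA⟩ := hφ.exists_polynomial hG hb n
  set ψ := exteriorInverse G φ
  -- At `ψ(w)` the difference is the negative-power part of the Laurent series plus `φ(ψ(w))^(n+1) -
  -- F_{n+1}(ψ(w))`; both tend to `0` at infinity.
  suffices A - faberPoly φ γ (n + 1) = 0 by rw [← sub_eq_zero.1 this, hA w hw]
  have ht := hφ.tendsto_inverse hG
  refine eq_zero_of_tendsto_eval_zero ht ?_
  have h1 := (hφ.tendsto_pow_sub_faberPoly hG (n + 1)).comp ht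
  have hβ := hb.bidiskSummable.hasSeriesOn_coeff n
  have h2 : Tendsto (fun w : ℂ => (n + 1) * ∑' i, b (n + 1) (i + 1) * w⁻¹ ^ (i + 1))
      (Bornology.cobounded ℂ) (𝓝 0) := by
    have hc := (hβ.differentiableAt (s := 0) (by simp)).continuousAt.tendsto
    have := (hc.comp tendsto_inv₀_cobounded).const_mul ((n : ℂ) + 1)
    simpa using this
  have h3 := h2.add h1
  rw [add_zero] at h3
  refine h3.congr' ?_
  filter_upwards [eventually_mem_exteriorDisk] with w hw
  simp only [Function.comp, Polynomial.eval_sub]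
  rw [hφ.rightInvOn hw, hA w hw]
  ring

end IsExteriorRiemannMap

/-! ### Laurent series and integrals over circles -/

theorem integral_exp_int_mul (n : ℤ) :
    ∫ θ in -Real.pi..Real.pi, Complex.exp (n * (θ * Complex.I)) =
      if n = 0 then 2 * (Real.pi : ℂ) else 0 := by
  by_cases hn : n = 0
  · simp [hn]
    ring
  · have hc : (n : ℂ) * Complex.I ≠ 0 := mul_ne_zero (by exact_mod_cast hn) Complex.I_ne_zero
    have h1 : ∀ θ : ℝ, Complex.exp (n * (θ * Complex.I)) = Complex.exp (n * Complex.I * θ) :=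
      fun θ => by congr 1; ring
    simp only [h1, hn, if_false]
    rw [integral_exp_mul_complex hc]
    have h2 : (n : ℂ) * Complex.I * (Real.pi : ℝ) =
        n * Complex.I * (-Real.pi : ℝ) + n * (2 * Real.pi * Complex.I) := by push_cast; ring
    rw [h2, Complex.exp_add, Complex.exp_int_mul_two_pi_mul_I, mul_one, sub_self, zero_div]

/-- Parseval's formula for absolutely convergent trigonometric series. -/
theorem hasSum_integral_mul_conj {a b : ℤ → ℂ} (ha : Summable fun j => ‖a j‖)
    (hb : Summable fun j => ‖b j‖) :
    HasSum (fun j => a j * conj (b j) * (2 * Real.pi))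
      (∫ θ in -Real.pi..Real.pi, (∑' j, a j * Complex.exp (j * (θ * Complex.I))) *
        conj (∑' j, b j * Complex.exp (j * (θ * Complex.I)))) := by
  have hexp : ∀ (j : ℤ) (θ : ℝ), ‖Complex.exp (j * (θ * Complex.I))‖ = 1 := fun j θ => by
    rw [← mul_assoc]
    exact_mod_cast Complex.norm_exp_ofReal_mul_I (j * θ)
  have hprod : ∀ θ : ℝ, HasSum (fun p : ℤ × ℤ => a p.1 * conj (b p.2) *
      Complex.exp ((p.1 - p.2 : ℤ) * (θ * Complex.I)))
      ((∑' j, a j * Complex.exp (j * (θ * Complex.I))) *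
      conj (∑' j, b j * Complex.exp (j * (θ * Complex.I)))) := by
    intro θ
    have h1 : Summable fun j => ‖a j * Complex.exp (j * (θ * Complex.I))‖ := by
      simpa [hexp] using ha
    have h2 : Summable fun j => ‖conj (b j * Complex.exp (j * (θ * Complex.I)))‖ := by
      simpa [hexp] using hb
    rw [Complex.conj_tsum, tsum_mul_tsum_of_summable_norm h1 h2]
    refine (summable_mul_of_summable_norm h1 h2).hasSum.congr_fun fun p => ?_
    simp only [map_mul, ← Complex.exp_conj, map_intCast, Complex.conj_I, Complex.conj_ofReal]
    rw [mul_mul_mul_comm, ← Complex.exp_add]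
    congr 2
    push_cast
    ring
  have hsum : Summable fun p : ℤ × ℤ => ‖a p.1 * conj (b p.2)‖ := by
    simpa using ha.mul_of_nonneg hb (fun _ => norm_nonneg _) (fun _ => norm_nonneg _)
  have hint := intervalIntegral.hasSum_integral_of_dominated_convergence
    (μ := volume) (a := -Real.pi) (b := Real.pi)
    (F := fun (p : ℤ × ℤ) (θ : ℝ) => a p.1 * conj (b p.2) *
      Complex.exp ((p.1 - p.2 : ℤ) * (θ * Complex.I)))
    (fun p _ => ‖a p.1 * conj (b p.2)‖)
    (fun p => (by fun_prop : Continuous fun θ : ℝ => a p.1 * conj (b p.2) *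
      Complex.exp ((p.1 - p.2 : ℤ) * (θ * Complex.I))).aestronglyMeasurable)
    (fun p => ae_of_all _ fun θ _ => by rw [norm_mul, hexp, mul_one])
    (ae_of_all _ fun θ _ => hsum) intervalIntegrable_const
    (ae_of_all _ fun θ _ => hprod θ)
  simp only [intervalIntegral.integral_const_mul, integral_exp_int_mul] at hint
  -- After termwise integration of the double series, the orthogonality of exponentials leaves only
  -- the diagonal terms.
  have hinj : Function.Injective fun j : ℤ => (j, j) := fun i j h => congrArg Prod.fst h
  refine ((hinj.hasSum_iff ?_).2 hint).congr_fun fun j => by simp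
  rintro ⟨i, j⟩ hij
  have : i - j ≠ 0 := fun h => hij ⟨i, by simp; linarith⟩
  simp [this]

/-- The coefficients of `w ^ N + ∑ u_l w ^ (-(l+1))`. -/
def laurentSeq (N : ℕ) (u : ℕ → ℂ) : ℤ → ℂ
  | Int.ofNat j => if j = N then 1 else 0
  | Int.negSucc l => u l

theorem hasSum_int {f : ℤ → ℂ} {x y : ℂ} (hx : HasSum (fun n : ℕ => f n) x)
    (hy : HasSum (fun n : ℕ => f (Int.negSucc n)) y) : HasSum f (x + y) := by
  refine HasSum.of_nat_of_neg_add_one hx (hy.congr_fun fun n => ?_)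
  rw [Int.negSucc_eq]

section Exterior

/-- Convergence in the exterior disk of `∑ u_l w ^ (-(l+1))`. -/
def ExteriorSummable (u : ℕ → ℂ) : Prop :=
  ∀ s : ℂ, ‖s‖ < 1 → Summable fun i => u i * s ^ (i + 1)

variable {N K : ℕ} {u v : ℕ → ℂ}

/-- `w ^ N + ∑ u_l w ^ (-(l+1))`. -/
noncomputable def laurentSum (N : ℕ) (u : ℕ → ℂ) (w : ℂ) : ℂ :=
  w ^ N + ∑' i, u i * w⁻¹ ^ (i + 1)

theorem ExteriorSummable.hasSeriesOn (hu : ExteriorSummable u) :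
    HasSeriesOn 1 (fun s => ∑' i, u i * s ^ (i + 1)) (fun n => if n = 0 then 0 else u (n - 1)) :=
  hasSeriesOn_succ fun s hs => (hu s hs).hasSum

theorem ExteriorSummable.hasSum_laurentSum (hu : ExteriorSummable u) {w : ℂ}
    (hw : w ∈ exteriorDisk) :
    HasSum (fun j : ℤ => laurentSeq N u j * w ^ j) (laurentSum N u w) := by
  refine hasSum_int ?_ ?_
  · have := hasSum_single (f := fun n : ℕ => laurentSeq N u n * w ^ (n : ℤ)) N
      (fun n hn => by simp [laurentSeq, hn])
    simpa [laurentSeq] using this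
  · refine (hu _ (norm_inv_lt_one hw)).hasSum.congr_fun fun n => ?_
    rw [zpow_negSucc, inv_pow]
    rfl

theorem ExteriorSummable.hasSum_mul_deriv (hu : ExteriorSummable u) {w : ℂ}
    (hw : w ∈ exteriorDisk) :
    HasDerivAt (laurentSum N u)
        (N * w ^ (N - 1) - w⁻¹ * ∑' i, (i + 1) * u i * w⁻¹ ^ (i + 1)) w ∧
      HasSum (fun j : ℤ => j * laurentSeq N u j * w ^ j) (w * deriv (laurentSum N u) w) := by
  have hw0 := ne_zero_of_mem_exteriorDisk hw
  have hw1 := norm_inv_lt_one hw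
  have h1 := hu.hasSeriesOn.deriv _ hw1
  simp only [Nat.add_eq_zero_iff, one_ne_zero, and_false, if_false, Nat.add_sub_cancel] at h1
  have h2 := h1.mul_right w⁻¹
  have h3 : HasSum (fun i : ℕ => (i + 1) * u i * w⁻¹ ^ (i + 1))
      (deriv (fun s => ∑' i, u i * s ^ (i + 1)) w⁻¹ * w⁻¹) :=
    h2.congr_fun fun n => by ring
  have hd : HasDerivAt (laurentSum N u)
      (N * w ^ (N - 1) - w⁻¹ * ∑' i, (i + 1) * u i * w⁻¹ ^ (i + 1)) w := by
    rw [h3.tsum_eq]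
    have hc := ((hu.hasSeriesOn.differentiableAt hw1).hasDerivAt.comp w (hasDerivAt_inv hw0))
    refine ((hasDerivAt_pow N w).add hc).congr_deriv ?_
    field_simp
    ring
  refine ⟨hd, ?_⟩
  have h4 : w * deriv (laurentSum N u) w = N * w ^ N +
      -(∑' i : ℕ, ((i : ℂ) + 1) * u i * w⁻¹ ^ (i + 1)) := by
    rw [hd.deriv, mul_sub, mul_inv_cancel_left₀ hw0]
    -- For `N = 0` the truncated exponent `N - 1` is harmless, because the factor `N` vanishes.
    rcases N.eq_zero_or_pos with rfl | hN
    · simp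
    · conv_rhs => rw [← Nat.sub_add_cancel hN, pow_succ]
      simp only [Nat.sub_add_cancel hN]
      ring
  rw [h4]
  refine hasSum_int ?_ ?_
  · have := hasSum_single (f := fun n : ℕ => ((n : ℤ) : ℂ) * laurentSeq N u n * w ^ (n : ℤ)) N
      (fun n hn => by simp [laurentSeq, hn])
    simpa [laurentSeq] using this
  · refine (h3.tsum_eq ▸ h3).neg.congr_fun fun n => ?_
    rw [zpow_negSucc, inv_pow, Int.cast_negSucc]
    simp only [laurentSeq]
    push_cast
    ring

theorem differentiableOn_laurentSum (hu : ExteriorSummable u) :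
    DifferentiableOn ℂ (laurentSum N u) exteriorDisk := fun _ hw =>
  (hu.hasSum_mul_deriv hw).1.differentiableAt.differentiableWithinAt

/-- The integral over a circle of `w p'(w) conj (q w)`. -/
theorem integral_circle_mul_conj (hu : ExteriorSummable u) (hv : ExteriorSummable v) {r : ℝ}
    (hr : 1 < r) :
    ∫ θ in -Real.pi..Real.pi,
      (r * Complex.exp (θ * Complex.I)) * deriv (laurentSum N u) (r * Complex.exp (θ * Complex.I)) *
        conj (laurentSum K v (r * Complex.exp (θ * Complex.I))) =
      2 * Real.pi * ((if N = K then N * (r : ℂ) ^ (2 * N) else 0) -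
        ∑' l : ℕ, (l + 1) * u l * conj (v l) * (r : ℂ)⁻¹ ^ (2 * (l + 1))) := by
  have hr0 : (r : ℂ) ≠ 0 := by exact_mod_cast (zero_lt_one.trans hr).ne'
  have hmem : ∀ θ : ℝ, (r : ℂ) * Complex.exp (θ * Complex.I) ∈ exteriorDisk := fun θ => by
    simp only [exteriorDisk, mem_ofPred_eq, norm_mul, Complex.norm_exp_ofReal_mul_I, mul_one,
      Complex.norm_real, Real.norm_eq_abs]
    exact hr.trans_le (le_abs_self r)
  have hrm : (r : ℂ) ∈ exteriorDisk := by simpa using hmem 0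
  have hpow : ∀ (j : ℤ) (θ : ℝ), ((r : ℂ) * Complex.exp (θ * Complex.I)) ^ j =
      (r : ℂ) ^ j * Complex.exp (j * (θ * Complex.I)) := fun j θ => by
    rw [mul_zpow, ← Complex.exp_int_mul]
  have ha := (hu.hasSum_mul_deriv (N := N) hrm).2.summable.norm
  have hb := (hv.hasSum_laurentSum (N := K) hrm).summable.norm
  have key := hasSum_integral_mul_conj ha hb
  have hs1 : ∀ θ : ℝ, ∑' j : ℤ, j * laurentSeq N u j * (r : ℂ) ^ j *
      Complex.exp (j * (θ * Complex.I)) = (r * Complex.exp (θ * Complex.I)) *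
        deriv (laurentSum N u) (r * Complex.exp (θ * Complex.I)) := fun θ => by
    rw [← (hu.hasSum_mul_deriv (hmem θ)).2.tsum_eq]
    simp only [hpow, mul_assoc]
  have hs2 : ∀ θ : ℝ, ∑' j : ℤ, laurentSeq K v j * (r : ℂ) ^ j *
      Complex.exp (j * (θ * Complex.I)) = laurentSum K v (r * Complex.exp (θ * Complex.I)) :=
    fun θ => by
    rw [← (hv.hasSum_laurentSum (hmem θ)).tsum_eq]
    simp only [hpow, mul_assoc]
  simp only [hs1, hs2] at key
  -- At the index `-(l+1)` the operator `w d/dw` contributes the factor `-(l+1)`, the source of the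
  -- minus sign in the formula.
  have hneg : ∀ l : ℕ, (Int.negSucc l : ℂ) * laurentSeq N u (Int.negSucc l) *
      (r : ℂ) ^ (Int.negSucc l) * conj (laurentSeq K v (Int.negSucc l) * (r : ℂ) ^ (Int.negSucc l)) *
      (2 * Real.pi) =
      (l + 1) * u l * conj (v l) * (r : ℂ)⁻¹ ^ (2 * (l + 1)) * -(2 * Real.pi) := fun l => by
    simp only [laurentSeq, zpow_negSucc, Int.cast_negSucc, map_mul, map_inv₀, map_pow,
      Complex.conj_ofReal]
    rw [← inv_pow, two_mul, pow_add]
    push_cast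
    ring
  have hsum := key.summable.comp_injective (i := Int.negSucc) fun i j h => Int.negSucc.inj h
  simp only [Function.comp_def, hneg] at hsum
  have hnat := hasSum_single (f := fun n : ℕ => ((n : ℤ) : ℂ) * laurentSeq N u n * (r : ℂ) ^ (n : ℤ) *
    conj (laurentSeq K v n * (r : ℂ) ^ (n : ℤ)) * (2 * Real.pi)) N
      (fun n hn => by simp [laurentSeq, hn])
  have h2 := hsum.hasSum.congr_fun (g := fun l : ℕ => (Int.negSucc l : ℂ) *
    laurentSeq N u (Int.negSucc l) * (r : ℂ) ^ (Int.negSucc l) *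
      conj (laurentSeq K v (Int.negSucc l) * (r : ℂ) ^ (Int.negSucc l)) * (2 * Real.pi)) hneg
  rw [key.unique (hasSum_int hnat h2), tsum_mul_right]
  by_cases h : N = K
  · simp only [laurentSeq, if_true, ← h, map_mul, map_one, Complex.conj_ofReal, zpow_natCast,
      map_pow]
    push_cast
    ring
  · simp [laurentSeq, h]
    ring

end Exterior

/-! ### Radially weighted integrals over the exterior disk -/

section Radial

variable {α β : ℝ} {m : ℝ → ℝ} {X : ℂ → ℂ}

/-- `X` is controlled only on the exterior disk, but the weight vanishes on `‖w‖ < α`, a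
neighbourhood of the closed unit disk as `α > 1`. -/
theorem continuous_radial_mul (hα : 1 < α) (hm : Continuous m) (h0 : ∀ x ≤ α ^ 2, m x = 0)
    (hX : ContinuousOn X exteriorDisk) : Continuous fun w : ℂ => (m (‖w‖ ^ 2) : ℂ) * X w := by
  rw [continuous_iff_continuousAt]
  intro w
  rcases lt_or_ge 1 ‖w‖ with hw | hw
  · refine ContinuousAt.mul (by fun_prop) (hX.continuousAt (isOpen_exteriorDisk.mem_nhds hw))
  · refine (continuousAt_const (y := (0 : ℂ))).congr ?_
    have : ∀ᶠ x : ℂ in 𝓝 w, ‖x‖ < α := continuous_norm.continuousAt.eventually_lt_const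
      (hw.trans_lt hα)
    filter_upwards [this] with x hx
    rw [h0 _ (by gcongr)]
    simp

/-- Polar coordinates. The weight confines the integrand to `α < r ≤ β`, which provides the
integrability for Fubini. -/
theorem integral_radial_mul (hα : 1 < α) (hαβ : α < β) (hm : Continuous m)
    (h0 : ∀ x ≤ α ^ 2, m x = 0) (h1 : ∀ x, β ^ 2 ≤ x → m x = 0)
    (hX : ContinuousOn X exteriorDisk) :
    ∫ w in exteriorDisk, (m (‖w‖ ^ 2) : ℂ) * X w = ∫ r in α..β, ((r * m (r ^ 2) : ℝ) : ℂ) *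
      ∫ θ in -Real.pi..Real.pi, X (r * Complex.exp (θ * Complex.I)) := by
  have hcont := continuous_radial_mul hα hm h0 hX
  have hzero : ∀ r : ℝ, 0 ≤ r → r ∉ Ioc α β → m (r ^ 2) = 0 := fun r hr h => by
    rcases le_or_gt r α with h' | h'
    · exact h0 _ (by gcongr)
    · have : β < r := by
        by_contra hc
        exact h ⟨h', not_lt.1 hc⟩
      exact h1 _ (pow_le_pow_left₀ (by linarith) this.le 2)
  rw [setIntegral_eq_integral_of_forall_compl_eq_zero (s := exteriorDisk) fun w hw => by
    have : ‖w‖ ≤ 1 := not_lt.1 hw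
    rw [h0 _ (pow_le_pow_left₀ (norm_nonneg w) (this.trans hα.le) 2)]
    simp, ← Complex.integral_comp_polarCoord_symm]
  have hpol : ∀ p : ℝ × ℝ, Complex.polarCoord.symm p = p.1 * Complex.exp (p.2 * Complex.I) := by
    intro p
    rw [Complex.polarCoord_symm_apply, Complex.exp_mul_I, Complex.ofReal_cos, Complex.ofReal_sin]
  have hF : Continuous fun p : ℝ × ℝ => p.1 • ((m (‖Complex.polarCoord.symm p‖ ^ 2) : ℂ) *
      X (Complex.polarCoord.symm p)) := by
    have : Continuous fun p : ℝ × ℝ => Complex.polarCoord.symm p := by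
      simp only [hpol]
      fun_prop
    exact continuous_fst.smul (hcont.comp this)
  have hnorm : ∀ p : ℝ × ℝ, ‖Complex.polarCoord.symm p‖ ^ 2 = p.1 ^ 2 := fun p => by
    rw [Complex.norm_polarCoord_symm, sq_abs]
  have hint : IntegrableOn (fun p : ℝ × ℝ => p.1 • ((m (‖Complex.polarCoord.symm p‖ ^ 2) : ℂ) *
      X (Complex.polarCoord.symm p))) (Ioi 0 ×ˢ Ioo (-Real.pi) Real.pi) (volume.prod volume) := by
    have hc : IsCompact (Icc (0 : ℝ) β ×ˢ Icc (-Real.pi) Real.pi) := isCompact_Icc.prod isCompact_Icc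
    refine (hF.continuousOn.integrableOn_compact hc).of_forall_sdiff_eq_zero
      (measurableSet_Ioi.prod measurableSet_Ioo) fun p hp => ?_
    have : p.1 ∉ Ioc α β := fun h => hp.2 ⟨⟨hp.1.1.le, h.2⟩, Ioo_subset_Icc_self hp.1.2⟩
    rw [hnorm, hzero _ hp.1.1.le this]
    simp
  rw [polarCoord_target, Measure.volume_eq_prod, setIntegral_prod _ hint,
    intervalIntegral.integral_of_le hαβ.le]
  have hsub : Ioc α β ⊆ Ioi 0 := fun r hr => (zero_lt_one.trans hα).trans hr.1
  rw [setIntegral_eq_of_subset_of_forall_sdiff_eq_zero measurableSet_Ioi hsub]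
  · refine setIntegral_congr_fun measurableSet_Ioc fun r hr => ?_
    simp only [hpol]
    rw [intervalIntegral.integral_of_le (by linarith [Real.pi_pos]),
      integral_Ioc_eq_integral_Ioo, ← integral_const_mul]
    congr 1 with θ
    simp [mul_assoc]
  · intro r hr
    simp only [hnorm, hzero r (le_of_lt hr.1) hr.2]
    simp

end Radial

/-! ### Radial cut-off functions -/

/-- A `C¹` cut-off function on the line. -/
theorem exists_cutoff {a b : ℝ} (hab : a < b) : ∃ (χ m : ℝ → ℝ), Continuous m ∧ (∀ x, 0 ≤ m x) ∧
    (∀ x ≤ a, m x = 0) ∧ (∀ x, b ≤ x → m x = 0) ∧ (∀ x, HasDerivAt χ (-m x) x) ∧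
    (∀ x ≤ a, χ x = 1) ∧ (∀ x, b ≤ x → χ x = 0) ∧ ∀ x, χ x ∈ Icc 0 1 := by
  -- A continuous bump positive exactly on `(a, b)`; `χ` is `1` minus its normalized primitive.
  set k : ℝ → ℝ := fun x => max 0 ((x - a) * (b - x)) with hk
  have hkc : Continuous k := by fun_prop
  have hk0 : ∀ x, 0 ≤ k x := fun x => le_max_left _ _
  have hka : ∀ x ≤ a, k x = 0 := fun x hx => max_eq_left
    (mul_nonpos_of_nonpos_of_nonneg (by linarith) (by linarith))
  have hkb : ∀ x, b ≤ x → k x = 0 := fun x hx => max_eq_left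
    (mul_nonpos_of_nonneg_of_nonpos (by linarith) (by linarith))
  set c := ∫ x in a..b, k x with hc
  have hcpos : 0 < c := by
    refine intervalIntegral.intervalIntegral_pos_of_pos_on (hkc.intervalIntegrable _ _) ?_ hab
    intro x hx
    exact lt_max_of_lt_right (mul_pos (by linarith [hx.1]) (by linarith [hx.2]))
  set χ : ℝ → ℝ := fun x => 1 - (∫ y in a..x, k y) / c with hχ
  have hd : ∀ x, HasDerivAt χ (-(k x / c)) x := fun x => by
    exact ((intervalIntegral.integral_hasDerivAt_right (hkc.intervalIntegrable _ _)
      hkc.aestronglyMeasurable.stronglyMeasurableAtFilter hkc.continuousAt).div_const c).const_sub 1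
  have hone : ∀ x ≤ a, χ x = 1 := fun x hx => by
    have : ∫ y in a..x, k y = 0 := by
      rw [intervalIntegral.integral_symm, neg_eq_zero]
      refine intervalIntegral.integral_zero_ae (ae_of_all _ fun y hy => hka y ?_)
      rw [uIoc_of_le hx] at hy
      exact hy.2
    simp [hχ, this]
  have hzero : ∀ x, b ≤ x → χ x = 0 := fun x hx => by
    have : ∫ y in a..x, k y = c := by
      rw [← intervalIntegral.integral_add_adjacent_intervals (hkc.intervalIntegrable a b)
        (hkc.intervalIntegrable b x), ← hc, add_eq_left]
      refine intervalIntegral.integral_zero_ae (ae_of_all _ fun y hy => hkb y ?_)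
      rw [uIoc_of_le hx] at hy
      exact hy.1.le
    simp [hχ, this, hcpos.ne']
  have hanti : Antitone χ := antitone_of_hasDerivAt_nonpos hd fun x =>
    neg_nonpos.2 (div_nonneg (hk0 x) hcpos.le)
  refine ⟨χ, fun x => k x / c, by fun_prop, fun x => div_nonneg (hk0 x) hcpos.le,
    fun x hx => by simp [hka x hx], fun x hx => by simp [hkb x hx], hd, hone, hzero,
    fun x => ⟨?_, ?_⟩⟩
  · rw [← hzero (max x b) (le_max_right _ _)]
    exact hanti (le_max_left _ _)
  · rw [← hone (min x a) (min_le_right _ _)]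
    exact hanti (min_le_left _ _)

/-! ### Cut-off functions built from the exterior Riemann map -/

namespace IsExteriorRiemannMap

variable {G : Set ℂ} {φ : ℂ → ℂ} {γ α : ℝ}

/-- The point is closedness in the whole plane, up to `Γ`. Since `ψ → ∞` at infinity, the part of
this set in a ball lies in the image under `ψ` of a compact annulus `α ≤ ‖w‖ ≤ R`, and that image is
a compact subset of `Ω`. -/
theorem isClosed_superlevel (hφ : IsExteriorRiemannMap G φ γ) (hG : Bornology.IsBounded G)
    (hα : 1 < α) : IsClosed {z | z ∈ exteriorDomain G ∧ α ≤ ‖φ z‖} := by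
  refine isClosed_of_closure_subset fun z hz => ?_
  have hev : ∀ᶠ w in Bornology.cobounded ℂ, exteriorInverse G φ w ∉ Metric.ball z 1 :=
    (hφ.tendsto_inverse hG).eventually (Bornology.isBounded_def.1 Metric.isBounded_ball)
  obtain ⟨R, hR⟩ : ∃ R : ℝ, ∀ w : ℂ, exteriorInverse G φ w ∈ Metric.ball z 1 → ‖w‖ ≤ R := by
    obtain ⟨R, -, hR⟩ := (Metric.hasBasis_cobounded_compl_closedBall (0 : ℂ)).eventually_iff.1 hev
    refine ⟨R, fun w hw => ?_⟩
    by_contra h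
    exact hR (by simpa using h) hw
  set T : Set ℂ := {w | α ≤ ‖w‖} ∩ Metric.closedBall 0 R with hT
  have hTc : IsCompact T :=
    (isCompact_closedBall (0 : ℂ) R).inter_left (isClosed_le continuous_const continuous_norm)
  have hTe : T ⊆ exteriorDisk := fun w hw => hα.trans_le hw.1
  have hK : IsCompact (exteriorInverse G φ '' T) :=
    hTc.image_of_continuousOn (hφ.differentiableOn_inverse.continuousOn.mono hTe)
  have hsub : {z | z ∈ exteriorDomain G ∧ α ≤ ‖φ z‖} ∩ Metric.ball z 1 ⊆
      exteriorInverse G φ '' T := by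
    rintro y ⟨⟨hy, hyα⟩, hyb⟩
    refine ⟨φ y, ⟨hyα, ?_⟩, hφ.leftInvOn hy⟩
    rw [mem_closedBall_zero_iff]
    exact hR _ (by rwa [hφ.leftInvOn hy])
  have hz2 : z ∈ closure ({z | z ∈ exteriorDomain G ∧ α ≤ ‖φ z‖} ∩ Metric.ball z 1) :=
    Metric.isOpen_ball.closure_inter ⟨hz, Metric.mem_ball_self one_pos⟩
  obtain ⟨w, hw, rfl⟩ := hK.isClosed.closure_subset_iff.2 hsub hz2
  exact ⟨hφ.mapsTo_inverse (hTe hw), by rw [hφ.rightInvOn (hTe hw)]; exact hw.1⟩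

theorem exists_radius (hφ : IsExteriorRiemannMap G φ γ) (hG : Bornology.IsBounded G) (β : ℝ) :
    ∃ R : ℝ, ∀ z ∉ Metric.closedBall (0 : ℂ) R, z ∈ exteriorDomain G ∧ β ≤ ‖φ z‖ := by
  have h1 : Tendsto (fun z => ‖φ z / z‖ * ‖z‖) (Bornology.cobounded ℂ) atTop := by
    refine hφ.tendsto_infty.norm.pos_mul_atTop ?_ tendsto_norm_cobounded_atTop
    simpa using hφ.pos.ne'
  have h2 : ∀ᶠ z in Bornology.cobounded ℂ, z ∈ exteriorDomain G ∧ β ≤ ‖φ z‖ := by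
    filter_upwards [eventually_mem_exteriorDomain hG, h1.eventually_ge_atTop β,
      Bornology.eventually_ne_cobounded (0 : ℂ)] with z hz hβ h0
    rw [← norm_mul, div_mul_cancel₀ _ h0] at hβ
    exact ⟨hz, hβ⟩
  obtain ⟨R, -, hR⟩ := (Metric.hasBasis_cobounded_compl_closedBall (0 : ℂ)).eventually_iff.1 h2
  exact ⟨R, fun z hz => hR hz⟩

/-- The half of `|φ| → 1` at the boundary that makes functions of `|φ|²`, constant on `x ≤ α²`,
extend across `Γ` without loss of regularity. -/
theorem eventually_norm_lt (hφ : IsExteriorRiemannMap G φ γ) (hG : Bornology.IsBounded G)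
    (hα : 1 < α) {z : ℂ} (hz : z ∉ exteriorDomain G) :
    ∀ᶠ y in 𝓝 z, y ∈ exteriorDomain G → ‖φ y‖ < α := by
  filter_upwards [(hφ.isClosed_superlevel hG hα).isOpen_compl.mem_nhds fun h => hz h.1]
    with y hy hyΩ
  by_contra h
  exact hy ⟨hyΩ, not_lt.1 h⟩

open Classical in
theorem continuous_indicator_mul (hφ : IsExteriorRiemannMap G φ γ) (hG : Bornology.IsBounded G)
    (hα : 1 < α) {m : ℝ → ℝ} (hm : Continuous m) (h0 : ∀ x ≤ α ^ 2, m x = 0) {Y : ℂ → ℂ}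
    (hY : ContinuousOn Y (exteriorDomain G)) :
    Continuous fun z => if z ∈ exteriorDomain G then (m (‖φ z‖ ^ 2) : ℂ) * Y z else 0 := by
  rw [continuous_iff_continuousAt]
  intro z
  by_cases hz : z ∈ exteriorDomain G
  · have hn := (isOpen_exteriorDomain G).mem_nhds hz
    have h1 : ContinuousAt φ z := hφ.differentiableOn.continuousOn.continuousAt hn
    have h2 : ContinuousAt (fun z => (m (‖φ z‖ ^ 2) : ℂ) * Y z) z := by
      refine ContinuousAt.mul ?_ (hY.continuousAt hn)
      exact Complex.continuous_ofReal.continuousAt.comp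
        (hm.continuousAt.comp (h1.norm.pow 2))
    refine h2.congr ?_
    filter_upwards [hn] with y hy
    simp [hy]
  · refine (continuousAt_const (y := (0 : ℂ))).congr ?_
    filter_upwards [hφ.eventually_norm_lt hG hα hz] with y hy
    split_ifs with h
    · rw [h0 _ (pow_le_pow_left₀ (norm_nonneg _) (hy h).le 2)]
      simp
    · rfl

end IsExteriorRiemannMap

open Classical in
/-- The function `χ(|φ|²)` on the exterior domain, extended by `1`. -/
noncomputable def exteriorCutoff (G : Set ℂ) (φ : ℂ → ℂ) (χ : ℝ → ℝ) (z : ℂ) : ℝ :=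
  if z ∈ exteriorDomain G then χ (‖φ z‖ ^ 2) else 1

open Classical in
/-- The derivative of `exteriorCutoff` in the direction `v`, where `χ' = -m`. -/
noncomputable def exteriorCutoffDeriv (G : Set ℂ) (φ : ℂ → ℂ) (m : ℝ → ℝ) (v z : ℂ) : ℂ :=
  if z ∈ exteriorDomain G then
    (m (‖φ z‖ ^ 2) : ℂ) * ((-2 * (conj (φ z) * (deriv φ z * v)).re : ℝ) : ℂ) else 0

namespace IsExteriorRiemannMap

variable {G : Set ℂ} {φ : ℂ → ℂ} {γ α β : ℝ} {χ m : ℝ → ℝ}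

/-- On `Ω` the derivative of `|φ|²` along `v` is `2 Re(conj(φ) φ' v)`; near any other point the
cut-off is identically `1`. -/
theorem hasLineDerivAt_cutoff (hφ : IsExteriorRiemannMap G φ γ) (hG : Bornology.IsBounded G)
    (hα : 1 < α) (h0 : ∀ x ≤ α ^ 2, χ x = 1) (hd : ∀ x, HasDerivAt χ (-m x) x) (v z : ℂ) :
    HasLineDerivAt ℝ (fun z => (exteriorCutoff G φ χ z : ℂ)) (exteriorCutoffDeriv G φ m v z)
      z v := by
  by_cases hz : z ∈ exteriorDomain G
  · have hn := (isOpen_exteriorDomain G).mem_nhds hz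
    have h1 : HasLineDerivAt ℝ φ (deriv φ z * v) z v := by
      simpa using (hφ.differentiableOn.differentiableAt hn).hasDerivAt.complexToReal_fderiv
        |>.hasLineDerivAt v
    have h2 : HasDerivAt (fun t : ℝ => ‖φ (z + t • v)‖ ^ 2)
        (2 * inner ℝ (φ z) (deriv φ z * v)) 0 := by
      simpa using HasDerivAt.norm_sq h1
    have h3 : HasDerivAt (fun t : ℝ => χ (‖φ (z + t • v)‖ ^ 2))
        (-m (‖φ z‖ ^ 2) * (2 * inner ℝ (φ z) (deriv φ z * v))) 0 := by
      have := HasDerivAt.comp (0 : ℝ) (h₂ := χ) (h := fun t : ℝ => ‖φ (z + t • v)‖ ^ 2)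
        (hd _) h2
      simp only [zero_smul, add_zero] at this
      exact this
    have h4 := h3.ofReal_comp
    have hval : exteriorCutoffDeriv G φ m v z =
        ((-m (‖φ z‖ ^ 2) * (2 * inner ℝ (φ z) (deriv φ z * v)) : ℝ) : ℂ) := by
      rw [exteriorCutoffDeriv, if_pos hz, Complex.inner]
      push_cast
      ring_nf
    rw [hval]
    refine HasDerivAt.congr_of_eventuallyEq h4 ?_
    have hcont : Tendsto (fun t : ℝ => z + t • v) (𝓝 0) (𝓝 z) := by
      have : Continuous fun t : ℝ => z + t • v := by fun_prop
      simpa using this.tendsto 0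
    filter_upwards [hcont hn] with t ht
    have ht' : z + t • v ∈ exteriorDomain G := ht
    simp only [exteriorCutoff, if_pos ht']
  · rw [exteriorCutoffDeriv, if_neg hz]
    refine HasDerivAt.congr_of_eventuallyEq (hasDerivAt_const (0 : ℝ) (1 : ℂ)) ?_
    have hcont : Tendsto (fun t : ℝ => z + t • v) (𝓝 0) (𝓝 z) := by
      have : Continuous fun t : ℝ => z + t • v := by fun_prop
      simpa using this.tendsto 0
    filter_upwards [hcont.eventually (hφ.eventually_norm_lt hG hα hz)] with t ht
    rw [exteriorCutoff]
    split_ifs with h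
    · rw [h0 _ (pow_le_pow_left₀ (norm_nonneg _) (ht h).le 2)]
      simp
    · simp

theorem continuous_cutoff (hφ : IsExteriorRiemannMap G φ γ) (hG : Bornology.IsBounded G)
    (hα : 1 < α) (hc : Continuous χ) (h0 : ∀ x ≤ α ^ 2, χ x = 1) :
    Continuous fun z => (exteriorCutoff G φ χ z : ℂ) := by
  have h := hφ.continuous_indicator_mul hG hα (m := fun x => 1 - χ x) (by fun_prop)
    (fun x hx => by simp [h0 x hx]) (Y := fun _ => 1) continuousOn_const
  refine (continuous_const (y := (1 : ℂ)).sub h).congr fun z => ?_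
  by_cases hz : z ∈ exteriorDomain G <;> simp [exteriorCutoff, hz]

theorem continuous_cutoffDeriv (hφ : IsExteriorRiemannMap G φ γ) (hG : Bornology.IsBounded G)
    (hα : 1 < α) (hm : Continuous m) (h0 : ∀ x ≤ α ^ 2, m x = 0) (v : ℂ) :
    Continuous (exteriorCutoffDeriv G φ m v) := by
  refine hφ.continuous_indicator_mul hG hα hm h0
    (Y := fun z => ((-2 * (conj (φ z) * (deriv φ z * v)).re : ℝ) : ℂ)) ?_
  have h1 := hφ.differentiableOn.continuousOn
  have h2 := (hφ.differentiableOn.deriv (isOpen_exteriorDomain G)).continuousOn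
  have h3 : ContinuousOn (fun z => conj (φ z) * (deriv φ z * v)) (exteriorDomain G) :=
    (Complex.continuous_conj.comp_continuousOn h1).mul (h2.mul continuousOn_const)
  exact Complex.continuous_ofReal.comp_continuousOn
    (continuousOn_const.mul (Complex.continuous_re.comp_continuousOn h3))

theorem hasCompactSupport_cutoff (hφ : IsExteriorRiemannMap G φ γ) (hG : Bornology.IsBounded G)
    (hβ : 0 ≤ β) (h1 : ∀ x, β ^ 2 ≤ x → χ x = 0) :
    HasCompactSupport fun z => (exteriorCutoff G φ χ z : ℂ) := by
  obtain ⟨R, hR⟩ := hφ.exists_radius hG β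
  refine HasCompactSupport.intro (isCompact_closedBall (0 : ℂ) R) fun z hz => ?_
  obtain ⟨hz1, hz2⟩ := hR z hz
  rw [exteriorCutoff, if_pos hz1, h1 _ (pow_le_pow_left₀ hβ hz2 2), Complex.ofReal_zero]

theorem hasCompactSupport_cutoffDeriv (hφ : IsExteriorRiemannMap G φ γ)
    (hG : Bornology.IsBounded G) (hβ : 0 ≤ β) (h1 : ∀ x, β ^ 2 ≤ x → m x = 0) (v : ℂ) :
    HasCompactSupport (exteriorCutoffDeriv G φ m v) := by
  obtain ⟨R, hR⟩ := hφ.exists_radius hG β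
  refine HasCompactSupport.intro (isCompact_closedBall (0 : ℂ) R) fun z hz => ?_
  obtain ⟨hz1, hz2⟩ := hR z hz
  rw [exteriorCutoffDeriv, if_pos hz1, h1 _ (pow_le_pow_left₀ hβ hz2 2), Complex.ofReal_zero,
    zero_mul]

/-- Integration by parts against the cut-off function. -/
theorem integral_cutoff_mul (hφ : IsExteriorRiemannMap G φ γ) (hG : Bornology.IsBounded G)
    (hα : 1 < α) (hαβ : α < β) (hm : Continuous m) (hm0 : ∀ x ≤ α ^ 2, m x = 0)
    (hm1 : ∀ x, β ^ 2 ≤ x → m x = 0) (hd : ∀ x, HasDerivAt χ (-m x) x)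
    (hχ0 : ∀ x ≤ α ^ 2, χ x = 1) (hχ1 : ∀ x, β ^ 2 ≤ x → χ x = 0) (P Q : Polynomial ℂ) :
    ∫ z, (exteriorCutoff G φ χ z : ℂ) * (P.derivative.eval z * conj (Q.derivative.eval z)) =
      ∫ z in exteriorDomain G, (m (‖φ z‖ ^ 2) : ℂ) *
        (conj (Q.eval z) * P.derivative.eval z * (φ z * conj (deriv φ z))) := by
  have hβ : 0 ≤ β := by linarith
  have hχc : Continuous χ := continuous_iff_continuousAt.2 fun x => (hd x).continuousAt
  set c : ℂ → ℂ := fun z => (exteriorCutoff G φ χ z : ℂ) with hc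
  have hcc : Continuous c := hφ.continuous_cutoff hG hα hχc hχ0
  have hcs : HasCompactSupport c := hφ.hasCompactSupport_cutoff hG hβ hχ1
  set f : ℂ → ℂ := fun z => conj (Q.eval z) * P.derivative.eval z with hf
  have hfc : Continuous f := by fun_prop
  set f' : ℂ → ℂ → ℂ := fun v z => conj (Q.derivative.eval z * v) * P.derivative.eval z +
    conj (Q.eval z) * (P.derivative.derivative.eval z * v) with hf'
  have hfc' : ∀ v, Continuous (f' v) := fun v => by fun_prop
  have hline : ∀ v z, HasLineDerivAt ℝ f (f' v z) z v := by
    intro v z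
    have hp : ∀ A : Polynomial ℂ,
        HasDerivAt (fun t : ℝ => A.eval (z + t • v)) (A.derivative.eval z * v) 0 := fun A => by
      have : HasLineDerivAt ℝ (fun z => A.eval z) (A.derivative.eval z * v) z v := by
        simpa using (A.hasDerivAt z).complexToReal_fderiv.hasLineDerivAt v
      exact this
    have := (hp Q).star.mul (hp P.derivative)
    simp only [zero_smul, add_zero] at this
    exact this
  have hibp : ∀ v, ∫ z, f z * exteriorCutoffDeriv G φ m v z = -∫ z, f' v z * c z := by
    intro v
    have hdc := hφ.continuous_cutoffDeriv hG hα hm hm0 v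
    have hds := hφ.hasCompactSupport_cutoffDeriv hG hβ hm1 v
    exact integral_bilinear_hasLineDerivAt_right_eq_neg_left_of_integrable
      (μ := (volume : Measure ℂ)) (B := ContinuousLinearMap.mul ℝ ℂ) (v := v)
      (((hfc' v).mul hcc).integrable_of_hasCompactSupport hcs.mul_left)
      ((hfc.mul hdc).integrable_of_hasCompactSupport hds.mul_left)
      ((hfc.mul hcc).integrable_of_hasCompactSupport hcs.mul_left)
      (fun z _ => hline v z)
      (fun z _ => hφ.hasLineDerivAt_cutoff hG hα hχ0 hd v z)
  have hi1 : ∀ v, Integrable fun z => f z * exteriorCutoffDeriv G φ m v z := fun v =>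
    (hfc.mul (hφ.continuous_cutoffDeriv hG hα hm hm0 v)).integrable_of_hasCompactSupport
      (hφ.hasCompactSupport_cutoffDeriv hG hβ hm1 v).mul_left
  have hi2 : ∀ v, Integrable fun z => f' v z * c z := fun v =>
    ((hfc' v).mul hcc).integrable_of_hasCompactSupport hcs.mul_left
  -- The combination `∂_1 + i ∂_i = 2 ∂̄` annihilates the holomorphic factor `P'`, so `2 ∂̄ (conj(Q)
  -- P') = 2 conj(Q') P'`.
  have hL : ∫ z, (f' 1 z * c z + Complex.I * (f' Complex.I z * c z)) =
      2 * ∫ z, c z * (P.derivative.eval z * conj (Q.derivative.eval z)) := by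
    rw [← integral_const_mul]
    congr 1 with z
    simp only [hf', map_mul, map_one, Complex.conj_I]
    linear_combination (c z * (-conj (Q.derivative.eval z) * P.derivative.eval z +
      conj (Q.eval z) * P.derivative.derivative.eval z)) * Complex.I_mul_I
  -- The same combination applied to the cut-off gives `2 ∂̄ χ(|φ|²) = -2 m(|φ|²) φ conj(φ')`.
  have hR : ∫ z, (f z * exteriorCutoffDeriv G φ m 1 z +
      Complex.I * (f z * exteriorCutoffDeriv G φ m Complex.I z)) =
      -2 * ∫ z in exteriorDomain G, (m (‖φ z‖ ^ 2) : ℂ) *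
        (conj (Q.eval z) * P.derivative.eval z * (φ z * conj (deriv φ z))) := by
    rw [← integral_const_mul, ← integral_indicator (isOpen_exteriorDomain G).measurableSet]
    congr 1 with z
    by_cases hz : z ∈ exteriorDomain G
    · rw [indicator_of_mem hz, exteriorCutoffDeriv, exteriorCutoffDeriv, if_pos hz, if_pos hz]
      have hc : ∀ x : ℂ, ((-2 * (x * 1).re : ℝ) : ℂ) +
          Complex.I * ((-2 * (x * Complex.I).re : ℝ) : ℂ) = -2 * conj x := fun x => by
        apply Complex.ext <;> simp
      have h3 := hc (conj (φ z) * deriv φ z)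
      simp only [map_mul, Complex.conj_conj, mul_assoc] at h3
      simp only [hf]
      linear_combination ((m (‖φ z‖ ^ 2) : ℂ) * conj (Q.eval z) * P.derivative.eval z) * h3
    · rw [indicator_of_notMem hz, exteriorCutoffDeriv, exteriorCutoffDeriv, if_neg hz, if_neg hz]
      simp
  rw [integral_add (hi2 1) ((hi2 Complex.I).const_mul _), integral_const_mul] at hL
  rw [integral_add (hi1 1) ((hi1 Complex.I).const_mul _), integral_const_mul, hibp, hibp] at hR
  linear_combination (-1 / 2 : ℂ) * hL - (1 / 2 : ℂ) * hR

/-- Change of variables `z = ψ(w)`. -/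
theorem integral_exteriorDomain (hφ : IsExteriorRiemannMap G φ γ) (P Q : Polynomial ℂ) :
    ∫ z in exteriorDomain G, (m (‖φ z‖ ^ 2) : ℂ) *
        (conj (Q.eval z) * P.derivative.eval z * (φ z * conj (deriv φ z))) =
      ∫ w in exteriorDisk, (m (‖w‖ ^ 2) : ℂ) *
        (w * deriv (fun w => P.eval (exteriorInverse G φ w)) w *
          conj (Q.eval (exteriorInverse G φ w))) := by
  -- The real Jacobian of `ψ` is `|ψ'|²`. As `ψ' = 1/φ'`, the product `conj(φ') |ψ'|²` is `ψ'`,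
  -- which completes `P'(ψ)` to the derivative of `P ∘ ψ`.
  have hdet : ∀ c : ℂ, (c • (1 : ℂ →L[ℝ] ℂ)).det = Complex.normSq c := fun c => by
    rw [← Algebra.norm_complex_apply, ContinuousLinearMap.det, Algebra.norm_apply]
    congr 1
  rw [← hφ.image_inverse, integral_image_eq_integral_abs_det_fderiv_smul volume
    isOpen_exteriorDisk.measurableSet
    (fun w hw => (hφ.hasDerivAt_inverse hw).complexToReal_fderiv.hasFDerivWithinAt)
    hφ.injOn_inverse]
  refine setIntegral_congr_fun isOpen_exteriorDisk.measurableSet fun w hw => ?_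
  have hne := hφ.deriv_ne_zero (hφ.mapsTo_inverse hw)
  have hder : deriv (fun w => P.eval (exteriorInverse G φ w)) w =
      P.derivative.eval (exteriorInverse G φ w) * (deriv φ (exteriorInverse G φ w))⁻¹ :=
    ((P.hasDerivAt _).comp w (hφ.hasDerivAt_inverse hw)).deriv
  rw [hdet, abs_of_nonneg (Complex.normSq_nonneg _), hφ.rightInvOn hw, hder,
    Complex.real_smul, Complex.normSq_eq_conj_mul_self, map_inv₀]
  have hne' : conj (deriv φ (exteriorInverse G φ w)) ≠ 0 := by simpa using hne
  field_simp

end IsExteriorRiemannMap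

/-! ### The area formula -/

section AreaForm

variable {N K : ℕ} {u v : ℕ → ℂ} {α β : ℝ}

/-- The value of `(2π)⁻¹ ∫ w p'(w) conj (q w)` over the circle of radius `r`. -/
noncomputable def areaForm (N K : ℕ) (u v : ℕ → ℂ) (r : ℝ) : ℂ :=
  (if N = K then N * (r : ℂ) ^ (2 * N) else 0) -
    ∑' l : ℕ, (l + 1) * u l * conj (v l) * (r : ℂ)⁻¹ ^ (2 * (l + 1))

theorem ExteriorSummable.summable_weighted (hu : ExteriorSummable u) (hv : ExteriorSummable v)
    (hα : 1 < α) : Summable fun l : ℕ => ((l : ℝ) + 1) * ‖u l‖ * ‖v l‖ * α⁻¹ ^ (2 * (l + 1)) := by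
  have hα0 : 0 < α := by linarith
  have hs : ‖((α⁻¹ : ℝ) : ℂ)‖ < 1 := by
    rw [Complex.norm_real, Real.norm_of_nonneg (by positivity)]
    exact inv_lt_one_of_one_lt₀ hα
  have h1 := ((hu.hasSeriesOn.deriv _ hs).summable.norm.mul_right α⁻¹)
  simp only [Nat.add_eq_zero_iff, one_ne_zero, and_false, if_false, Nat.add_sub_cancel] at h1
  have h2 := (h1.mul_of_nonneg (hv _ hs).norm (fun _ => by positivity)
    (fun _ => norm_nonneg _)).comp_injective (i := fun l : ℕ => (l, l))
      fun i j h => congrArg Prod.fst h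
  refine h2.congr fun l => ?_
  have h3 : ‖(l : ℂ) + 1‖ = (l : ℝ) + 1 := by
    rw [← Nat.cast_succ, Complex.norm_natCast, Nat.cast_succ]
  simp only [Function.comp, norm_mul, norm_pow, h3, Complex.norm_real,
    Real.norm_of_nonneg (inv_nonneg.2 hα0.le)]
  ring

theorem norm_areaForm_term (l : ℕ) {r : ℝ} (hr : 0 < r) :
    ‖((l : ℂ) + 1) * u l * conj (v l) * (r : ℂ)⁻¹ ^ (2 * (l + 1))‖ =
      ((l : ℝ) + 1) * ‖u l‖ * ‖v l‖ * r⁻¹ ^ (2 * (l + 1)) := by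
  have h3 : ‖(l : ℂ) + 1‖ = (l : ℝ) + 1 := by
    rw [← Nat.cast_succ, Complex.norm_natCast, Nat.cast_succ]
  simp only [norm_mul, norm_pow, h3, Complex.norm_real, norm_inv, RCLike.norm_conj,
    Real.norm_of_nonneg hr.le]

/-- Summability is a hypothesis so that `α = 1` is allowed, once it is known there from the area
theorem. -/
theorem continuousOn_areaForm (hα : 0 < α)
    (h : Summable fun l : ℕ => ((l : ℝ) + 1) * ‖u l‖ * ‖v l‖ * α⁻¹ ^ (2 * (l + 1))) :
    ContinuousOn (areaForm N K u v) (Ici α) := by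
  have h0 : ∀ r ∈ Ici α, (r : ℂ) ≠ 0 := fun r hr => by exact_mod_cast (hα.trans_le hr).ne'
  refine ContinuousOn.sub ?_ (continuousOn_tsum (fun l => ?_) h fun l r hr => ?_)
  · split_ifs <;> fun_prop
  · exact continuousOn_const.mul ((Complex.continuous_ofReal.continuousOn.inv₀ h0).pow _)
  · rw [norm_areaForm_term l (hα.trans_le hr)]
    have := inv_anti₀ hα hr
    have : 0 ≤ r⁻¹ := inv_nonneg.2 (hα.le.trans hr)
    gcongr

end AreaForm

namespace IsExteriorRiemannMap

variable {G : Set ℂ} {φ : ℂ → ℂ} {γ α β : ℝ} {N K : ℕ} {u v : ℕ → ℂ} {P Q : Polynomial ℂ}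

/-- Weighted form of the area formula. -/
theorem exists_weight (hφ : IsExteriorRiemannMap G φ γ) (hG : Bornology.IsBounded G)
    (hα : 1 < α) (hαβ : α < β) : ∃ (c : ℂ → ℝ) (ρ : ℝ → ℝ),
      Continuous (fun z => (c z : ℂ)) ∧ (∀ z, c z ∈ Icc 0 1) ∧
      (∀ z ∉ exteriorDomain G, c z = 1) ∧ (∀ z ∈ exteriorDomain G, β ≤ ‖φ z‖ → c z = 0) ∧
      Continuous ρ ∧ (∀ r ∈ Icc α β, 0 ≤ ρ r) ∧ ∫ r in α..β, ρ r = 1 ∧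
      ∀ (N K : ℕ) (u v : ℕ → ℂ) (P Q : Polynomial ℂ),
        ExteriorSummable u → ExteriorSummable v →
        (∀ w ∈ exteriorDisk, P.eval (exteriorInverse G φ w) = laurentSum N u w) →
        (∀ w ∈ exteriorDisk, Q.eval (exteriorInverse G φ w) = laurentSum K v w) →
        ∫ z, (c z : ℂ) * (P.derivative.eval z * conj (Q.derivative.eval z)) =
          Real.pi * ∫ r in α..β, (ρ r : ℂ) * areaForm N K u v r := by
  have hα0 : 0 < α := by linarith
  obtain ⟨χ, m, hm, hmpos, hm0, hm1, hd, hχ0, hχ1, hχ⟩ :=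
    exists_cutoff (pow_lt_pow_left₀ hαβ hα0.le two_ne_zero)
  have hχc : Continuous χ := continuous_iff_continuousAt.2 fun x => (hd x).continuousAt
  -- The density `2 r m(r²)` is minus the derivative of `χ(r²)`, so its mass is `χ(α²) - χ(β²) = 1`.
  refine ⟨exteriorCutoff G φ χ, fun r => 2 * r * m (r ^ 2),
    hφ.continuous_cutoff hG hα hχc hχ0, fun z => ?_, fun z hz => by rw [exteriorCutoff, if_neg hz],
    fun z hz hβ => ?_, by fun_prop, fun r hr => ?_, ?_, ?_⟩
  · rw [exteriorCutoff]
    split_ifs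
    · exact hχ _
    · simp
  · rw [exteriorCutoff, if_pos hz, hχ1 _ (pow_le_pow_left₀ (by linarith) hβ 2)]
  · have := hmpos (r ^ 2)
    have : 0 ≤ r := hα0.le.trans hr.1
    positivity
  · have hder : ∀ r ∈ uIcc α β, HasDerivAt (fun r => -χ (r ^ 2)) (2 * r * m (r ^ 2)) r := by
      intro r _
      refine (HasDerivAt.comp r (hd (r ^ 2)) (hasDerivAt_pow 2 r)).neg.congr_deriv ?_
      norm_num
      ring
    rw [intervalIntegral.integral_eq_sub_of_hasDerivAt hder
      (Continuous.intervalIntegrable (by fun_prop) _ _), hχ0 _ le_rfl, hχ1 _ le_rfl]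
    ring
  · intro N K u v P Q hu hv hP hQ
    rw [hφ.integral_cutoff_mul hG hα hαβ hm hm0 hm1 hd hχ0 hχ1 P Q, hφ.integral_exteriorDomain P Q]
    have hX : ∀ w ∈ exteriorDisk, w * deriv (fun w => P.eval (exteriorInverse G φ w)) w *
        conj (Q.eval (exteriorInverse G φ w)) =
        w * deriv (laurentSum N u) w * conj (laurentSum K v w) := fun w hw => by
      have : (fun w => P.eval (exteriorInverse G φ w)) =ᶠ[𝓝 w] laurentSum N u := by
        filter_upwards [isOpen_exteriorDisk.mem_nhds hw] with x hx using hP x hx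
      rw [this.deriv_eq, hQ w hw]
    rw [setIntegral_congr_fun (g := fun w => (m (‖w‖ ^ 2) : ℂ) *
      (w * deriv (laurentSum N u) w * conj (laurentSum K v w))) isOpen_exteriorDisk.measurableSet
      fun w hw => by simp only [hX w hw]]
    have hd1 := differentiableOn_laurentSum (N := N) hu
    have hd2 := differentiableOn_laurentSum (N := K) hv
    rw [integral_radial_mul (X := fun w => w * deriv (laurentSum N u) w * conj (laurentSum K v w))
      hα hαβ hm hm0 hm1 ((continuousOn_id.mul (hd1.deriv isOpen_exteriorDisk).continuousOn).mul
        (Complex.continuous_conj.comp_continuousOn hd2.continuousOn)),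
      ← intervalIntegral.integral_const_mul]
    refine intervalIntegral.integral_congr fun r hr => ?_
    rw [uIcc_of_le hαβ.le] at hr
    have := integral_circle_mul_conj (N := N) (K := K) hu hv (hα.trans_le hr.1)
    simp only [this, areaForm]
    push_cast
    ring

/-- Discarding all but `L` of the nonnegative terms and replacing `r` by `β` gives a bound
independent of `r`, usable before convergence at `r = 1` is known. -/
theorem re_areaForm_le {r : ℝ} (hu : ExteriorSummable u) (hα : 1 < r) (hr : r ≤ β) (L : ℕ) :
    (areaForm N N u u r).re ≤ N * β ^ (2 * N) -
      ∑ l ∈ Finset.range L, ((l : ℝ) + 1) * ‖u l‖ ^ 2 * β⁻¹ ^ (2 * (l + 1)) := by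
  have hr0 : 0 < r := by linarith
  have hs := hu.summable_weighted hu hα
  have hterm : ∀ l : ℕ, ((l : ℂ) + 1) * u l * conj (u l) * (r : ℂ)⁻¹ ^ (2 * (l + 1)) =
      ((((l : ℝ) + 1) * ‖u l‖ * ‖u l‖ * r⁻¹ ^ (2 * (l + 1)) : ℝ) : ℂ) := fun l => by
    rw [mul_assoc ((l : ℂ) + 1), Complex.mul_conj, Complex.normSq_eq_norm_sq]
    push_cast
    ring
  have hre : (areaForm N N u u r).re = N * r ^ (2 * N) -
      ∑' l : ℕ, ((l : ℝ) + 1) * ‖u l‖ * ‖u l‖ * r⁻¹ ^ (2 * (l + 1)) := by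
    simp only [areaForm, if_true, hterm]
    rw [← Complex.ofReal_tsum, Complex.sub_re, Complex.ofReal_re]
    congr 1
    exact_mod_cast Complex.ofReal_re (N * r ^ (2 * N))
  rw [hre]
  have h1 : (N : ℝ) * r ^ (2 * N) ≤ N * β ^ (2 * N) := by gcongr
  have h2 := hs.sum_le_tsum (Finset.range L) fun l _ => by positivity
  have h3 : ∑ l ∈ Finset.range L, ((l : ℝ) + 1) * ‖u l‖ ^ 2 * β⁻¹ ^ (2 * (l + 1)) ≤
      ∑ l ∈ Finset.range L, ((l : ℝ) + 1) * ‖u l‖ * ‖u l‖ * r⁻¹ ^ (2 * (l + 1)) := by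
    refine Finset.sum_le_sum fun l _ => ?_
    rw [sq, ← mul_assoc]
    have : 0 ≤ β⁻¹ := inv_nonneg.2 (hr0.le.trans hr)
    gcongr
  linarith

/-- The area theorem: square summability of Laurent coefficients. -/
theorem summable_sq (hφ : IsExteriorRiemannMap G φ γ) (hG : Bornology.IsBounded G)
    (hu : ExteriorSummable u)
    (hP : ∀ w ∈ exteriorDisk, P.eval (exteriorInverse G φ w) = laurentSum N u w) :
    Summable fun l : ℕ => ((l : ℝ) + 1) * ‖u l‖ ^ 2 := by
  -- The weighted integral of `|P'|²` is nonnegative, hence so is the `ρ`-average of the area form.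
  -- Letting `β → 1` afterwards bounds all partial sums by `N`.
  have key : ∀ L : ℕ, ∀ β : ℝ, 1 < β →
      ∑ l ∈ Finset.range L, ((l : ℝ) + 1) * ‖u l‖ ^ 2 * β⁻¹ ^ (2 * (l + 1)) ≤ N * β ^ (2 * N) := by
    intro L β hβ
    obtain ⟨α, hα, hαβ⟩ := exists_between hβ
    obtain ⟨c, ρ, hc, hc01, -, -, hρ, hρ0, hρ1, hid⟩ := hφ.exists_weight hG hα hαβ
    have h := congrArg Complex.re (hid N N u u P P hu hu hP hP)
    set C := N * β ^ (2 * N) -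
      ∑ l ∈ Finset.range L, ((l : ℝ) + 1) * ‖u l‖ ^ 2 * β⁻¹ ^ (2 * (l + 1)) with hC
    have hcont := continuousOn_areaForm (N := N) (K := N) (by linarith : 0 < α)
      (hu.summable_weighted hu hα)
    have hcont' : ContinuousOn (areaForm N N u u) (uIcc α β) := hcont.mono (by
      rw [uIcc_of_le hαβ.le]
      exact Icc_subset_Ici_self)
    have hlhs : (∫ z, (c z : ℂ) * (P.derivative.eval z * conj (P.derivative.eval z))) =
        ((∫ z, c z * ‖P.derivative.eval z‖ ^ 2 : ℝ) : ℂ) := by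
      rw [← integral_complex_ofReal]
      congr 1 with z
      rw [Complex.mul_conj, Complex.normSq_eq_norm_sq]
      push_cast
      ring
    have hpos : 0 ≤ ∫ z, c z * ‖P.derivative.eval z‖ ^ 2 :=
      integral_nonneg fun z => mul_nonneg (hc01 z).1 (by positivity)
    rw [hlhs, Complex.ofReal_re, Complex.re_ofReal_mul] at h
    have hint : IntervalIntegrable (fun r => (ρ r : ℂ) * areaForm N N u u r) volume α β :=
      ((Complex.continuous_ofReal.comp hρ).continuousOn.mul hcont').intervalIntegrable
    have hre : (∫ r in α..β, (ρ r : ℂ) * areaForm N N u u r).re =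
        ∫ r in α..β, ρ r * (areaForm N N u u r).re := by
      have := Complex.reCLM.intervalIntegral_comp_comm hint
      simpa [Complex.re_ofReal_mul] using this.symm
    have hle : ∫ r in α..β, ρ r * (areaForm N N u u r).re ≤ ∫ r in α..β, ρ r * C := by
      refine intervalIntegral.integral_mono_on hαβ.le ?_
        (Continuous.intervalIntegrable (by fun_prop) _ _) fun r hr => ?_
      · exact (hρ.continuousOn.mul
          (Complex.continuous_re.comp_continuousOn hcont')).intervalIntegrable
      · exact mul_le_mul_of_nonneg_left (re_areaForm_le hu (hα.trans_le hr.1) hr.2 L) (hρ0 r hr)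
    rw [intervalIntegral.integral_mul_const, hρ1, one_mul] at hle
    rw [h, hre] at hpos
    have := nonneg_of_mul_nonneg_right hpos Real.pi_pos
    linarith
  refine summable_of_sum_range_le (c := N) (fun l => by positivity) fun L => ?_
  have h1 : Tendsto (fun β : ℝ => ∑ l ∈ Finset.range L,
      ((l : ℝ) + 1) * ‖u l‖ ^ 2 * β⁻¹ ^ (2 * (l + 1))) (𝓝[>] 1)
      (𝓝 (∑ l ∈ Finset.range L, ((l : ℝ) + 1) * ‖u l‖ ^ 2 * (1 : ℝ)⁻¹ ^ (2 * (l + 1)))) := by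
    refine tendsto_nhdsWithin_of_tendsto_nhds (tendsto_finsetSum _ fun l _ => ?_)
    exact ((tendsto_inv₀ one_ne_zero).pow _).const_mul _
  have h2 : Tendsto (fun β : ℝ => (N : ℝ) * β ^ (2 * N)) (𝓝[>] 1) (𝓝 (N * 1 ^ (2 * N))) :=
    tendsto_nhdsWithin_of_tendsto_nhds ((tendsto_id.pow _).const_mul _)
  have h3 := le_of_tendsto_of_tendsto h1 h2
    (eventually_nhdsWithin_of_forall fun β hβ => key L β hβ)
  simpa using h3

/-- The area formula. -/
theorem integral_closure (hφ : IsExteriorRiemannMap G φ γ) (hG : Bornology.IsBounded G)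
    (hu : ExteriorSummable u) (hv : ExteriorSummable v)
    (hP : ∀ w ∈ exteriorDisk, P.eval (exteriorInverse G φ w) = laurentSum N u w)
    (hQ : ∀ w ∈ exteriorDisk, Q.eval (exteriorInverse G φ w) = laurentSum K v w) :
    ∫ z in closure G, P.derivative.eval z * conj (Q.derivative.eval z) =
      Real.pi * areaForm N K u v 1 := by
  have hsum : Summable fun l : ℕ => ((l : ℝ) + 1) * ‖u l‖ * ‖v l‖ * (1 : ℝ)⁻¹ ^ (2 * (l + 1)) := by
    refine Summable.of_nonneg_of_le (fun l => by positivity) (fun l => ?_)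
      ((hφ.summable_sq hG hu hP).add (hφ.summable_sq hG hv hQ))
    simp only [inv_one, one_pow, mul_one]
    have : ‖u l‖ * ‖v l‖ ≤ ‖u l‖ ^ 2 + ‖v l‖ ^ 2 := by
      nlinarith [sq_nonneg (‖u l‖ - ‖v l‖), sq_nonneg ‖u l‖, sq_nonneg ‖v l‖]
    calc _ = ((l : ℝ) + 1) * (‖u l‖ * ‖v l‖) := by ring
      _ ≤ ((l : ℝ) + 1) * (‖u l‖ ^ 2 + ‖v l‖ ^ 2) := by gcongr
      _ = _ := by ring
  have hS := continuousOn_areaForm (N := N) (K := K) one_pos hsum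
  set f : ℂ → ℂ := fun z => P.derivative.eval z * conj (Q.derivative.eval z) with hf
  have hfc : Continuous f := by fun_prop
  -- Radii `1 < a_j < b_j ≤ 3` with `b_j → 1`; the bound `3` gives all cut-offs a common compact
  -- support.
  set a : ℕ → ℝ := fun j => 1 + 1 / ((j : ℝ) + 1) with ha
  set b : ℕ → ℝ := fun j => 1 + 2 / ((j : ℝ) + 1) with hb
  have ha1 : ∀ j, 1 < a j := fun j => by
    have : 0 < 1 / ((j : ℝ) + 1) := by positivity
    simp only [ha]
    linarith
  have hab : ∀ j, a j < b j := fun j => by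
    simp only [ha, hb]
    gcongr
    norm_num
  have hb3 : ∀ j, b j ≤ 3 := fun j => by
    have : 2 / ((j : ℝ) + 1) ≤ 2 := div_le_self (by norm_num) (by linarith [j.cast_nonneg (α := ℝ)])
    simp only [hb]
    linarith
  have hblim : Tendsto b atTop (𝓝 1) := by
    have : Tendsto (fun j : ℕ => 1 + 2 * (1 / ((j : ℝ) + 1))) atTop (𝓝 (1 + 2 * 0)) :=
      (tendsto_one_div_add_atTop_nhds_zero_nat.const_mul 2).const_add 1
    rw [mul_zero, add_zero] at this
    refine this.congr fun j => ?_
    rw [mul_one_div]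
  choose c ρ hc hc01 hc1 hc0 hρ hρ0 hρ1 hid using fun j => hφ.exists_weight hG (ha1 j) (hab j)
  obtain ⟨R, hR⟩ := hφ.exists_radius hG 3
  -- The cut-offs tend pointwise to the indicator of `closure G`: on `Ω` one has `|φ| > 1`, hence
  -- eventually `|φ| > b_j`.
  have hlim1 : Tendsto (fun j => ∫ z, (c j z : ℂ) * f z) atTop
      (𝓝 (∫ z, (closure G).indicator f z)) := by
    refine tendsto_integral_of_dominated_convergence
      ((Metric.closedBall (0 : ℂ) R).indicator fun z => ‖f z‖)
      (fun j => ((hc j).mul hfc).aestronglyMeasurable) ?_ (fun j => ae_of_all _ fun z => ?_)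
      (ae_of_all _ fun z => ?_)
    · rw [integrable_indicator_iff measurableSet_closedBall]
      exact hfc.norm.continuousOn.integrableOn_compact (isCompact_closedBall _ _)
    · by_cases hz : z ∈ Metric.closedBall (0 : ℂ) R
      · rw [indicator_of_mem hz, norm_mul, Complex.norm_real, Real.norm_of_nonneg (hc01 j z).1]
        exact mul_le_of_le_one_left (norm_nonneg _) (hc01 j z).2
      · obtain ⟨h1, h2⟩ := hR z hz
        rw [hc0 j z h1 ((hb3 j).trans h2), indicator_of_notMem hz]
        simp
    · by_cases hz : z ∈ exteriorDomain G
      · have hn : 1 < ‖φ z‖ := hφ.bijOn.mapsTo hz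
        rw [indicator_of_notMem hz]
        refine tendsto_const_nhds.congr' ?_
        filter_upwards [hblim.eventually_lt_const hn] with j hj
        rw [hc0 j z hz hj.le]
        simp
      · have hz' : z ∈ closure G := not_not.1 hz
        rw [indicator_of_mem hz']
        simp only [hc1 _ z hz]
        simp
  -- The `ρ_j` are probability densities concentrating at `1`, where the area form is continuous
  -- from the right.
  have hlim2 : Tendsto (fun j => ∫ r in a j..b j, (ρ j r : ℂ) * areaForm N K u v r) atTop
      (𝓝 (areaForm N K u v 1)) := by
    rw [Metric.tendsto_atTop']
    intro ε hε
    have h1 := (hS 1 self_mem_Ici).tendsto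
    obtain ⟨δ, hδ, hδ'⟩ := Metric.tendsto_nhdsWithin_nhds.1 h1 (ε / 2) (by positivity)
    obtain ⟨j0, hj0⟩ := eventually_atTop.1 (hblim.eventually_lt_const (by linarith : 1 < 1 + δ))
    refine ⟨j0, fun j hj => ?_⟩
    have hsub : uIcc (a j) (b j) ⊆ Ici 1 := by
      rw [uIcc_of_le (hab j).le]
      exact fun r hr => (ha1 j).le.trans hr.1
    have hρc : Continuous fun r => (ρ j r : ℂ) := Complex.continuous_ofReal.comp (hρ j)
    have hone : ∫ r in a j..b j, (ρ j r : ℂ) * areaForm N K u v 1 = areaForm N K u v 1 := by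
      rw [intervalIntegral.integral_mul_const, intervalIntegral.integral_ofReal, hρ1]
      simp
    rw [dist_eq_norm]
    nth_rewrite 1 [← hone]
    have hi1 : IntervalIntegrable (fun r => (ρ j r : ℂ) * areaForm N K u v r) volume (a j) (b j) :=
      (hρc.continuousOn.mul (hS.mono hsub)).intervalIntegrable
    have hi2 : IntervalIntegrable (fun r => (ρ j r : ℂ) * areaForm N K u v 1) volume (a j) (b j) :=
      (hρc.continuousOn.mul continuousOn_const).intervalIntegrable
    rw [← intervalIntegral.integral_sub hi1 hi2]
    refine (intervalIntegral.norm_integral_le_of_norm_le (hab j).le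
      (g := fun r => ρ j r * (ε / 2)) (ae_of_all _ fun r hr => ?_)
      (Continuous.intervalIntegrable (by have := hρ j; fun_prop) _ _)).trans_lt ?_
    · rw [← mul_sub, norm_mul, Complex.norm_real,
        Real.norm_of_nonneg (hρ0 j r ⟨hr.1.le, hr.2⟩)]
      refine mul_le_mul_of_nonneg_left ?_ (hρ0 j r ⟨hr.1.le, hr.2⟩)
      have hr1 : 1 < r := (ha1 j).trans hr.1
      have := hδ' (mem_Ici.2 hr1.le) (by
        rw [Real.dist_eq, abs_of_pos (by linarith)]
        linarith [hj0 j hj.le, hr.2])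
      rw [dist_eq_norm] at this
      exact this.le
    · rw [intervalIntegral.integral_mul_const, hρ1]
      linarith
  have hlim3 := hlim2.const_mul (Real.pi : ℂ)
  have heq := tendsto_nhds_unique (hlim1.congr fun j => hid j N K u v P Q hu hv hP hQ) hlim3
  rw [← heq, integral_indicator isClosed_closure.measurableSet]

theorem integral_domain (hφ : IsExteriorRiemannMap G φ γ) (hGo : IsOpen G)
    (hG : Bornology.IsBounded G) (hΓ : volume (frontier G) = 0)
    (hu : ExteriorSummable u) (hv : ExteriorSummable v)
    (hP : ∀ w ∈ exteriorDisk, P.eval (exteriorInverse G φ w) = laurentSum N u w)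
    (hQ : ∀ w ∈ exteriorDisk, Q.eval (exteriorInverse G φ w) = laurentSum K v w) :
    ∫ z in G, P.derivative.eval z * conj (Q.derivative.eval z) =
      Real.pi * areaForm N K u v 1 := by
  rw [← hφ.integral_closure hG hu hv hP hQ]
  refine setIntegral_congr_set ?_
  refine (LE.le.eventuallyLE (subset_closure (s := G))).antisymm ?_
  rw [ae_le_set, ← hGo.frontier_eq]
  exact hΓ

end IsExteriorRiemannMap

/-! ### Orthonormal functions on the exterior disk -/

/-- The function `√((l+1)/π) w ^ (-(l+2))`. -/
noncomputable def exteriorMonomial (l : ℕ) (w : ℂ) : ℂ :=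
  (√(((l : ℝ) + 1) / Real.pi) : ℝ) * w⁻¹ ^ (l + 2)

theorem aestronglyMeasurable_exteriorMonomial (l : ℕ) (μ : Measure ℂ) :
    AEStronglyMeasurable (exteriorMonomial l) μ := by
  have : Measurable (exteriorMonomial l) := by
    unfold exteriorMonomial
    fun_prop
  exact this.aestronglyMeasurable

theorem memLp_exteriorMonomial (l : ℕ) :
    MemLp (exteriorMonomial l) 2 (volume.restrict exteriorDisk) := by
  rw [memLp_two_iff_integrable_sq_norm (aestronglyMeasurable_exteriorMonomial l _)]
  -- For `‖w‖ > 1` one has `1 + ‖w‖ ≤ 2 ‖w‖`, so `‖w‖⁻⁴ ≤ 16 (1 + ‖w‖)⁻⁴`, integrable because `4`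
  -- exceeds the real dimension `2`.
  have h1 : Integrable (fun w : ℂ => (16 * (((l : ℝ) + 1) / Real.pi)) * (1 + ‖w‖) ^ (-(4 : ℝ)))
      (volume.restrict exteriorDisk) :=
    ((integrable_one_add_norm (by simp [Complex.finrank_real_complex]; norm_num)).integrableOn).const_mul _
  refine h1.mono' ((aestronglyMeasurable_exteriorMonomial l _).norm.pow 2) ?_
  filter_upwards [ae_restrict_mem isOpen_exteriorDisk.measurableSet] with w hw
  have hw1 : 1 < ‖w‖ := hw
  have hpos : 0 < ‖w‖ := by linarith
  have hc : 0 ≤ ((l : ℝ) + 1) / Real.pi := by positivity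
  rw [Real.norm_of_nonneg (by positivity), exteriorMonomial, norm_mul, mul_pow, norm_pow, norm_inv,
    Complex.norm_real, Real.norm_of_nonneg (Real.sqrt_nonneg _), Real.sq_sqrt hc, ← pow_mul]
  have h2 : ‖w‖⁻¹ ^ ((l + 2) * 2) ≤ ‖w‖⁻¹ ^ 4 :=
    pow_le_pow_of_le_one (by positivity) (inv_le_one_of_one_le₀ hw1.le) (by omega)
  have h3 : ‖w‖⁻¹ ^ 4 ≤ 16 * (1 + ‖w‖) ^ (-(4 : ℝ)) := by
    rw [Real.rpow_neg (by positivity), show (4 : ℝ) = ((4 : ℕ) : ℝ) by norm_num,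
      Real.rpow_natCast, inv_pow, ← div_eq_mul_inv, inv_eq_one_div,
      div_le_div_iff₀ (by positivity) (by positivity)]
    have : (1 + ‖w‖) ^ 4 ≤ (2 * ‖w‖) ^ 4 := pow_le_pow_left₀ (by positivity) (by linarith) 4
    calc 1 * (1 + ‖w‖) ^ 4 ≤ (2 * ‖w‖) ^ 4 := by rw [one_mul]; exact this
      _ = _ := by ring
  calc _ ≤ ((l : ℝ) + 1) / Real.pi * (16 * (1 + ‖w‖) ^ (-(4 : ℝ))) := by
        gcongr
        exact h2.trans h3
    _ = _ := by ring

/-- In polar coordinates the integrand separates; for `l = k` the norm is `(l+1)/π · 2π · ∫_1^∞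
r^(-2l-3) dr = 1`. -/
theorem integral_exteriorMonomial_mul_conj (l k : ℕ) :
    ∫ w in exteriorDisk, exteriorMonomial l w * conj (exteriorMonomial k w) =
      if l = k then 1 else 0 := by
  have hpol : ∀ p : ℝ × ℝ, Complex.polarCoord.symm p = p.1 * Complex.exp (p.2 * Complex.I) := by
    intro p
    rw [Complex.polarCoord_symm_apply, Complex.exp_mul_I, Complex.ofReal_cos, Complex.ofReal_sin]
  set C : ℂ := ((√(((l : ℝ) + 1) / Real.pi) * √(((k : ℝ) + 1) / Real.pi) : ℝ) : ℂ) with hC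
  set g : ℝ → ℂ := (Ioi (1 : ℝ)).indicator fun r => C * (r * (r : ℂ)⁻¹ ^ (l + k + 4)) with hg
  have hfac : ∀ p ∈ polarCoord.target,
      p.1 • exteriorDisk.indicator (fun w => exteriorMonomial l w * conj (exteriorMonomial k w))
        (Complex.polarCoord.symm p) = g p.1 * Complex.exp ((k - l : ℤ) * (p.2 * Complex.I)) := by
    rintro ⟨r, θ⟩ ⟨hr, -⟩
    have hr0 : (0 : ℝ) < r := hr
    have hmem : Complex.polarCoord.symm (r, θ) ∈ exteriorDisk ↔ r ∈ Ioi (1 : ℝ) := by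
      rw [exteriorDisk, mem_ofPred_eq, Complex.norm_polarCoord_symm, abs_of_pos hr0]
      rfl
    by_cases h : r ∈ Ioi (1 : ℝ)
    · have hconj : conj (Complex.exp (θ * Complex.I)) = Complex.exp (-(θ * Complex.I)) := by
        rw [← Complex.exp_conj]
        simp
      simp only [hg]
      rw [indicator_of_mem (hmem.2 h), indicator_of_mem h, hpol]
      simp only [exteriorMonomial, map_mul, map_pow, map_inv₀, Complex.conj_ofReal,
        hconj, mul_inv, mul_pow, Complex.real_smul, hC]
      simp only [← Complex.exp_neg, ← Complex.exp_nat_mul]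
      have he : Complex.exp ((k - l : ℤ) * (θ * Complex.I)) =
          Complex.exp ((l + 2 : ℕ) * -(θ * Complex.I)) *
            Complex.exp ((k + 2 : ℕ) * -(-(θ * Complex.I))) := by
        rw [← Complex.exp_add]
        congr 1
        push_cast
        ring
      rw [he]
      push_cast
      ring
    · simp only [hg]
      rw [indicator_of_notMem (fun h' => h (hmem.1 h')), indicator_of_notMem h]
      simp
  rw [← integral_indicator isOpen_exteriorDisk.measurableSet,
    ← Complex.integral_comp_polarCoord_symm,
    setIntegral_congr_fun polarCoord.open_target.measurableSet hfac, polarCoord_target,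
    Measure.volume_eq_prod,
    setIntegral_prod_mul g (fun θ : ℝ => Complex.exp ((k - l : ℤ) * (θ * Complex.I))),
    ← integral_Ioc_eq_integral_Ioo,
    ← intervalIntegral.integral_of_le (by linarith [Real.pi_pos]), integral_exp_int_mul]
  by_cases hlk : l = k
  · subst hlk
    have h1 : ∫ r in Ioi (0 : ℝ), g r = C * ((1 / (2 * (l : ℝ) + 2) : ℝ) : ℂ) := by
      rw [hg, setIntegral_indicator measurableSet_Ioi, Ioi_inter_Ioi,
        max_eq_right zero_le_one, integral_const_mul]
      congr 1
      have h2 := integral_Ioi_rpow_of_lt (a := -(2 * (l : ℝ) + 3)) (by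
        have : (0 : ℝ) ≤ l := l.cast_nonneg
        linarith) one_pos
      have h3 : -(1 : ℝ) ^ (-(2 * (l : ℝ) + 3) + 1) / (-(2 * (l : ℝ) + 3) + 1) =
          1 / (2 * (l : ℝ) + 2) := by
        rw [Real.one_rpow, show -(2 * (l : ℝ) + 3) + 1 = -(2 * l + 2) by ring, neg_div_neg_eq]
      rw [← h3, ← h2, ← integral_complex_ofReal]
      refine setIntegral_congr_fun measurableSet_Ioi fun r hr => ?_
      have hr0 : (0 : ℝ) < r := zero_lt_one.trans hr
      have h4 : r ^ (-(2 * (l : ℝ) + 3)) = r * r⁻¹ ^ (l + l + 4) := by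
        rw [Real.rpow_neg hr0.le, show 2 * (l : ℝ) + 3 = ((2 * l + 3 : ℕ) : ℝ) by push_cast; ring,
          Real.rpow_natCast, inv_pow, show l + l + 4 = (2 * l + 3) + 1 by ring, pow_succ]
        field_simp
        ring
      simp only [h4]
      push_cast
      rfl
    rw [h1, hC, Real.mul_self_sqrt (by positivity)]
    simp only [sub_self, if_true]
    have : (l : ℂ) + 1 ≠ 0 := by exact_mod_cast l.succ_ne_zero
    have hpi : (Real.pi : ℂ) ≠ 0 := by exact_mod_cast Real.pi_ne_zero
    have h2l : 2 * (l : ℂ) + 2 ≠ 0 := by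
      rw [show 2 * (l : ℂ) + 2 = 2 * (l + 1) by ring]
      exact mul_ne_zero two_ne_zero this
    push_cast
    field_simp
  · have : (k : ℤ) - l ≠ 0 := by omega
    simp [this, hlk]

/-- The elements of `L²` of the exterior disk given by `exteriorMonomial`. -/
noncomputable def exteriorMonomialLp (l : ℕ) : Lp ℂ 2 (volume.restrict exteriorDisk) :=
  (memLp_exteriorMonomial l).toLp _

theorem inner_toLp {μ : Measure ℂ} {f g : ℂ → ℂ} (hf : MemLp f 2 μ) (hg : MemLp g 2 μ) :
    inner ℂ (hf.toLp f) (hg.toLp g) = ∫ z, g z * conj (f z) ∂μ := by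
  rw [L2.inner_def]
  refine integral_congr_ae ?_
  filter_upwards [hf.coeFn_toLp, hg.coeFn_toLp] with z h1 h2
  rw [h1, h2]
  rfl

theorem orthonormal_exteriorMonomialLp : Orthonormal ℂ exteriorMonomialLp := by
  classical
  rw [orthonormal_iff_ite]
  intro l k
  rw [exteriorMonomialLp, exteriorMonomialLp, inner_toLp, integral_exteriorMonomial_mul_conj]
  simp only [eq_comm]

/-- The isometry of `ℓ²` into `L²` of the exterior disk. -/
noncomputable def exteriorIsometry : Ell2 →ₗᵢ[ℂ] Lp ℂ 2 (volume.restrict exteriorDisk) :=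
  orthonormal_exteriorMonomialLp.orthogonalFamily.linearIsometry

/-- Partial sums converge in `L²`, hence almost everywhere along a subsequence, and the pointwise
limit is `r`. -/
theorem exteriorIsometry_ae_eq (c : Ell2) {r : ℂ → ℂ}
    (hr : ∀ w ∈ exteriorDisk, HasSum (fun l => c l * exteriorMonomial l w) (r w)) :
    exteriorIsometry c =ᵐ[volume.restrict exteriorDisk] r := by
  have h1 := orthonormal_exteriorMonomialLp.orthogonalFamily.hasSum_linearIsometry c
  simp only [LinearIsometry.toSpanSingleton_apply] at h1
  obtain ⟨ns, hns, hae⟩ :=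
    (tendstoInMeasure_of_tendsto_Lp h1.tendsto_sum_nat).exists_seq_tendsto_ae
  have h2 : ∀ N : ℕ, (∑ l ∈ Finset.range N, c l • exteriorMonomialLp l : Lp ℂ 2 _)
      =ᵐ[volume.restrict exteriorDisk]
      fun w => ∑ l ∈ Finset.range N, c l * exteriorMonomial l w := by
    intro N
    induction N with
    | zero =>
      simp only [Finset.range_zero, Finset.sum_empty]
      exact Lp.coeFn_zero _ _ _
    | succ N ih =>
      simp only [Finset.sum_range_succ]
      filter_upwards [Lp.coeFn_add (∑ l ∈ Finset.range N, c l • exteriorMonomialLp l)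
        (c N • exteriorMonomialLp N), ih, Lp.coeFn_smul (c N) (exteriorMonomialLp N),
        (memLp_exteriorMonomial N).coeFn_toLp] with w e1 e2 e3 e4
      rw [e1, Pi.add_apply, e2, e3, Pi.smul_apply, exteriorMonomialLp, e4, smul_eq_mul]
  filter_upwards [hae, ae_all_iff.2 h2, ae_restrict_mem isOpen_exteriorDisk.measurableSet]
    with w e1 e2 hw
  simp only [e2] at e1
  exact tendsto_nhds_unique e1 ((hr w hw).tendsto_sum_nat.comp hns.tendsto_atTop)

theorem memLp_of_hasSum {c : Ell2} {r : ℂ → ℂ}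
    (hr : ∀ w ∈ exteriorDisk, HasSum (fun l => c l * exteriorMonomial l w) (r w)) :
    MemLp r 2 (volume.restrict exteriorDisk) :=
  (memLp_congr_ae (exteriorIsometry_ae_eq c hr)).1 (Lp.memLp _)

theorem l2Inner_of_hasSum {c d : Ell2} {r t : ℂ → ℂ}
    (hr : ∀ w ∈ exteriorDisk, HasSum (fun l => c l * exteriorMonomial l w) (r w))
    (ht : ∀ w ∈ exteriorDisk, HasSum (fun l => d l * exteriorMonomial l w) (t w)) :
    l2Inner exteriorDisk r t = inner ℂ d c := by
  rw [← exteriorIsometry.inner_map_map, L2.inner_def, l2Inner]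
  refine integral_congr_ae ?_
  filter_upwards [exteriorIsometry_ae_eq c hr, exteriorIsometry_ae_eq d ht] with w h1 h2
  rw [h1, h2]
  rfl

/-! ### Bounded operators on `ℓ²` with prescribed columns -/

/-- Expanding squares, the Gram identity reads `‖∑ x a‖² + ‖∑ x d‖² = ‖∑ x f‖²`. -/
theorem norm_linearCombination_le {E F H : Type*} [NormedAddCommGroup E] [InnerProductSpace ℂ E]
    [NormedAddCommGroup F] [InnerProductSpace ℂ F] [NormedAddCommGroup H] [InnerProductSpace ℂ H]
    {a : ℕ → E} {d : ℕ → F} {f : ℕ → H}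
    (h : ∀ n k, inner ℂ (a k) (a n) + inner ℂ (d k) (d n) = inner ℂ (f k) (f n)) (x : ℕ →₀ ℂ) :
    ‖Finsupp.linearCombination ℂ a x‖ ≤ ‖Finsupp.linearCombination ℂ f x‖ := by
  have key : inner ℂ (Finsupp.linearCombination ℂ a x) (Finsupp.linearCombination ℂ a x) +
      inner ℂ (Finsupp.linearCombination ℂ d x) (Finsupp.linearCombination ℂ d x) =
      inner ℂ (Finsupp.linearCombination ℂ f x) (Finsupp.linearCombination ℂ f x) := by
    simp only [Finsupp.linearCombination_apply, Finsupp.sum_inner, Finsupp.inner_sum,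
      inner_smul_left, inner_smul_right, ← h, mul_add]
    simp only [Finsupp.sum, Finset.sum_add_distrib, mul_add]
  have h2 := congrArg Complex.re key
  simp only [inner_self_eq_norm_sq_to_K, Complex.add_re] at h2
  norm_cast at h2
  refine (pow_le_pow_iff_left₀ (norm_nonneg _) (norm_nonneg _) two_ne_zero).1 ?_
  have h3 := sq_nonneg ‖Finsupp.linearCombination ℂ d x‖
  have h4 : ‖Finsupp.linearCombination ℂ a x‖ ^ 2 + ‖Finsupp.linearCombination ℂ d x‖ ^ 2 =
    ‖Finsupp.linearCombination ℂ f x‖ ^ 2 := by exact_mod_cast h2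
  linarith

theorem denseRange_linearCombination_e : DenseRange (Finsupp.linearCombination ℂ e) := by
  intro y
  refine mem_closure_of_tendsto (lp.hasSum_single (by norm_num) y) (Eventually.of_forall fun s => ?_)
  refine ⟨∑ i ∈ s, Finsupp.single i (y i), ?_⟩
  rw [map_sum]
  refine Finset.sum_congr rfl fun i _ => ?_
  rw [Finsupp.linearCombination_single, e, ← lp.single_smul, smul_eq_mul, mul_one]

/-- The map `e n ↦ a n` is contractive on the dense span of the canonical vectors, so it extends to
`ℓ²`. -/
theorem exists_continuousLinearMap_of_columns {F : Type*} [NormedAddCommGroup F]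
    [InnerProductSpace ℂ F] {a : ℕ → Ell2} {d : ℕ → F}
    (h : ∀ n k, inner ℂ (a k) (a n) + inner ℂ (d k) (d n) = inner ℂ (e k) (e n)) :
    ∃ C : Ell2 →L[ℂ] Ell2, ∀ n, C (e n) = a n := by
  refine ⟨(Finsupp.linearCombination ℂ a).extendOfNorm (Finsupp.linearCombination ℂ e),
    fun n => ?_⟩
  have := LinearMap.extendOfNorm_eq (f := Finsupp.linearCombination ℂ a)
    denseRange_linearCombination_e
    ⟨1, fun x => by rw [one_mul]; exact norm_linearCombination_le h x⟩ (Finsupp.single n 1)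
  simpa using this

/-! ### The Gram matrix of the Faber derivatives -/

theorem ExteriorSummable.summable_deriv {u : ℕ → ℂ} (hu : ExteriorSummable u) {w : ℂ}
    (hw : w ∈ exteriorDisk) :
    Summable fun i : ℕ => ((i : ℂ) + 1) * u i * w⁻¹ ^ (i + 1) := by
  have h1 := (hu.hasSeriesOn.deriv _ (norm_inv_lt_one hw)).summable.mul_right w⁻¹
  simp only [Nat.add_eq_zero_iff, one_ne_zero, and_false, if_false, Nat.add_sub_cancel] at h1
  exact h1.congr fun n => by ring

theorem ofReal_sqrt_mul_self {x : ℝ} (hx : 0 ≤ x) : ((√x : ℝ) : ℂ) * ((√x : ℝ) : ℂ) = x := by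
  rw [← Complex.ofReal_mul, Real.mul_self_sqrt hx]

theorem ofReal_sqrt_succ_ne_zero (n : ℕ) : ((√((n : ℝ) + 1) : ℝ) : ℂ) ≠ 0 := by
  have : (0 : ℝ) < n + 1 := n.cast_add_one_pos
  exact_mod_cast (Real.sqrt_pos.2 this).ne'

theorem ofReal_sqrt_succ_mul_self (n : ℕ) :
    ((√((n : ℝ) + 1) : ℝ) : ℂ) * ((√((n : ℝ) + 1) : ℝ) : ℂ) = n + 1 := by
  rw [ofReal_sqrt_mul_self n.cast_add_one_pos.le]
  push_cast
  rfl

theorem ofReal_sqrt_pi_ne_zero : ((√Real.pi : ℝ) : ℂ) ≠ 0 := by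
  exact_mod_cast (Real.sqrt_pos.2 Real.pi_pos).ne'

theorem memLp_faberDeriv {G : Set ℂ} (hG : Bornology.IsBounded G) (φ : ℂ → ℂ) (γ : ℝ) (n : ℕ) :
    MemLp (faberDeriv φ γ n) 2 (volume.restrict G) := by
  have hc : Continuous (faberDeriv φ γ n) := by
    unfold faberDeriv
    fun_prop
  have hK : IsCompact (closure G) := hG.isCompact_closure
  have : IsFiniteMeasure (volume.restrict (closure G)) :=
    ⟨by rw [Measure.restrict_apply_univ]; exact hK.measure_lt_top⟩
  obtain ⟨M, hM⟩ := hK.exists_bound_of_continuousOn hc.continuousOn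
  refine (MemLp.of_bound hc.aestronglyMeasurable M ?_).mono_measure
    (Measure.restrict_mono subset_closure le_rfl)
  filter_upwards [ae_restrict_mem isClosed_closure.measurableSet] with z hz using hM z hz

namespace IsExteriorRiemannMap

variable {G : Set ℂ} {φ : ℂ → ℂ} {γ : ℝ}

theorem exteriorSummable_grunskyCoeff (hφ : IsExteriorRiemannMap G φ γ)
    (hG : Bornology.IsBounded G) (n : ℕ) :
    ExteriorSummable fun l => (n + 1) * grunskyCoeff G φ γ (n + 1) (l + 1) := by
  intro s hs
  have h := ((hφ.isGrunskyCoeffs hG).bidiskSummable.summable hs (t := 1 / 2)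
    (by norm_num)).prod_factor n
  refine (h.mul_left (((n : ℂ) + 1) * ((1 / 2 : ℂ) ^ (n + 1))⁻¹)).congr fun i => ?_
  field_simp

theorem faberPoly_eval_inverse_eq_laurentSum (hφ : IsExteriorRiemannMap G φ γ)
    (hG : Bornology.IsBounded G) (n : ℕ) :
    ∀ w ∈ exteriorDisk, (faberPoly φ γ (n + 1)).eval (exteriorInverse G φ w) =
      laurentSum (n + 1) (fun l => (n + 1) * grunskyCoeff G φ γ (n + 1) (l + 1)) w := by
  intro w hw
  rw [hφ.faberPoly_eval_inverse hG (hφ.isGrunskyCoeffs hG) n hw, laurentSum, add_comm,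
    ← tsum_mul_left]
  simp only [mul_assoc]

theorem grunskyMatrix_comm (hφ : IsExteriorRiemannMap G φ γ) (hG : Bornology.IsBounded G)
    (n k : ℕ) : grunskyMatrix G φ γ n k = grunskyMatrix G φ γ k n := by
  rw [grunskyMatrix, grunskyMatrix, (hφ.isGrunskyCoeffs hG).coeff_comm n k,
    mul_comm (√((n : ℝ) + 1))]

/-- With `u_l = (n+1) b_{n+1,l+1}` one has `(l+1) |u_l|² / (n+1) = |C_{n,l}|²`, so this is the area
theorem for `F_{n+1}`. -/
theorem memℓp_grunskyMatrix (hφ : IsExteriorRiemannMap G φ γ) (hG : Bornology.IsBounded G)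
    (n : ℕ) : Memℓp (fun l => grunskyMatrix G φ γ n l) 2 := by
  refine memℓp_gen ?_
  have h := (hφ.summable_sq hG (hφ.exteriorSummable_grunskyCoeff hG n)
    (hφ.faberPoly_eval_inverse_eq_laurentSum hG n)).mul_left ((n : ℝ) + 1)⁻¹
  refine h.congr fun l => ?_
  have hn : (0 : ℝ) < n + 1 := n.cast_add_one_pos
  have hl : (0 : ℝ) < l + 1 := l.cast_add_one_pos
  have h3 : ‖(n : ℂ) + 1‖ = (n : ℝ) + 1 := by
    rw [← Nat.cast_succ, Complex.norm_natCast, Nat.cast_succ]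
  rw [grunskyMatrix, norm_mul, norm_mul, Complex.norm_real, Real.norm_of_nonneg (by positivity), h3,
    ENNReal.toReal_ofNat, Real.rpow_ofNat, mul_pow, mul_pow, mul_pow, Real.sq_sqrt hn.le,
    Real.sq_sqrt hl.le]
  field_simp

/-- The rows of the Grunsky matrix, as elements of `ℓ²`. -/
noncomputable def grunskyRow (hφ : IsExteriorRiemannMap G φ γ) (hG : Bornology.IsBounded G)
    (n : ℕ) : Ell2 :=
  ⟨fun l => grunskyMatrix G φ γ n l, hφ.memℓp_grunskyMatrix hG n⟩

theorem grunskyRow_apply (hφ : IsExteriorRiemannMap G φ γ) (hG : Bornology.IsBounded G)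
    (n l : ℕ) : hφ.grunskyRow hG n l = grunskyMatrix G φ γ n l := rfl

/-- The area formula for `F_{n+1}` and `F_{k+1}`, divided by `π √(n+1) √(k+1)`. It involves only
rows of the matrix, so it precedes boundedness of the operator and serves to prove it. -/
theorem l2Inner_faberDeriv (hφ : IsExteriorRiemannMap G φ γ) (hGo : IsOpen G)
    (hG : Bornology.IsBounded G) (hΓ : volume (frontier G) = 0) (n k : ℕ) :
    l2Inner G (faberDeriv φ γ n) (faberDeriv φ γ k) =
      (if n = k then 1 else 0) - inner ℂ (hφ.grunskyRow hG k) (hφ.grunskyRow hG n) := by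
  have h := hφ.integral_domain hGo hG hΓ (hφ.exteriorSummable_grunskyCoeff hG n)
    (hφ.exteriorSummable_grunskyCoeff hG k) (hφ.faberPoly_eval_inverse_eq_laurentSum hG n)
    (hφ.faberPoly_eval_inverse_eq_laurentSum hG k)
  have hπ := ofReal_sqrt_pi_ne_zero
  have hππ := ofReal_sqrt_mul_self Real.pi_pos.le
  have hn := ofReal_sqrt_succ_ne_zero n
  have hnn := ofReal_sqrt_succ_mul_self n
  have hk := ofReal_sqrt_succ_ne_zero k
  have hkk := ofReal_sqrt_succ_mul_self k
  set S : ℂ := ((√Real.pi : ℝ) : ℂ) with hS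
  set A : ℂ := ((√((n : ℝ) + 1) : ℝ) : ℂ) with hA
  set B : ℂ := ((√((k : ℝ) + 1) : ℝ) : ℂ) with hB
  have hSc : conj S = S := Complex.conj_ofReal _
  have hBc : conj B = B := Complex.conj_ofReal _
  have h1 : l2Inner G (faberDeriv φ γ n) (faberDeriv φ γ k) =
      (S * S * A * B)⁻¹ * (Real.pi * areaForm (n + 1) (k + 1)
        (fun l => (n + 1) * grunskyCoeff G φ γ (n + 1) (l + 1))
        (fun l => (k + 1) * grunskyCoeff G φ γ (k + 1) (l + 1)) 1) := by
    rw [← h, ← integral_const_mul, l2Inner]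
    congr 1
    ext z
    simp only [faberDeriv, map_div₀, map_mul, Complex.ofReal_mul, ← hS, ← hA, ← hB, hSc, hBc]
    field_simp
  have h2 : inner ℂ (hφ.grunskyRow hG k) (hφ.grunskyRow hG n) = (A * B)⁻¹ *
      ∑' l : ℕ, ((l : ℂ) + 1) * ((n + 1) * grunskyCoeff G φ γ (n + 1) (l + 1)) *
        conj ((k + 1) * grunskyCoeff G φ γ (k + 1) (l + 1)) := by
    rw [lp.inner_eq_tsum, ← tsum_mul_left]
    refine tsum_congr fun l => ?_
    change grunskyMatrix G φ γ n l * conj (grunskyMatrix G φ γ k l) = _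
    have hll := ofReal_sqrt_succ_mul_self l
    simp only [grunskyMatrix, map_mul, Complex.ofReal_mul, ← hA, ← hB, hBc, map_add,
      map_natCast, map_one]
    rw [← hll, ← hnn, ← hkk, Complex.conj_ofReal]
    field_simp
  rw [h1, h2, areaForm, ← hππ]
  clear h h1 h2
  simp only [Complex.ofReal_one, inv_one, one_pow, mul_one, Nat.add_right_cancel_iff]
  generalize (∑' l : ℕ, ((l : ℂ) + 1) * ((n + 1) * grunskyCoeff G φ γ (n + 1) (l + 1)) *
    conj ((k + 1) * grunskyCoeff G φ γ (k + 1) (l + 1))) = T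
  have hNB : (if n = k then ((n + 1 : ℕ) : ℂ) else 0) = A * B * if n = k then 1 else 0 := by
    split_ifs with hnk
    · subst hnk
      push_cast
      rw [mul_one, ← hnn]
    · simp
  rw [hNB]
  field_simp

/-- Differentiate the Laurent expansion of `F_{n+1} ∘ ψ`: the normalized derivative of `w^(n+1)` is
exactly the subtracted monomial, and the negative powers yield `-C_{n,l} √((l+1)/π) w^(-l-2)`. -/
theorem hasSum_faberResidual (hφ : IsExteriorRiemannMap G φ γ) (hG : Bornology.IsBounded G)
    (n : ℕ) : ∀ w ∈ exteriorDisk,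
      HasSum (fun l => (-hφ.grunskyRow hG n) l * exteriorMonomial l w)
        (faberResidual G φ γ n w) := by
  intro w hw
  have hu := hφ.exteriorSummable_grunskyCoeff hG n
  have hP := hφ.faberPoly_eval_inverse_eq_laurentSum hG n
  have h1 : HasDerivAt (fun w => (faberPoly φ γ (n + 1)).eval (exteriorInverse G φ w)) _ w :=
    ((faberPoly φ γ (n + 1)).hasDerivAt (exteriorInverse G φ w)).comp w
      (hφ.differentiableOn_inverse.differentiableAt (isOpen_exteriorDisk.mem_nhds hw)).hasDerivAt
  have h2 := h1.unique ((hu.hasSum_mul_deriv (N := n + 1) hw).1.congr_of_eventuallyEq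
    (by filter_upwards [isOpen_exteriorDisk.mem_nhds hw] with v hv using hP v hv))
  have hπ := ofReal_sqrt_pi_ne_zero
  have hn := ofReal_sqrt_succ_ne_zero n
  have hnn := ofReal_sqrt_succ_mul_self n
  have hdiv : ∀ m : ℕ, ((√(((m : ℝ) + 1) / Real.pi) : ℝ) : ℂ) =
      ((√((m : ℝ) + 1) : ℝ) : ℂ) / ((√Real.pi : ℝ) : ℂ) := fun m => by
    rw [Real.sqrt_div m.cast_add_one_pos.le, Complex.ofReal_div]
  have h3 := (hu.summable_deriv hw).hasSum.mul_left
    (-(w⁻¹ / (((√Real.pi : ℝ) : ℂ) * ((√((n : ℝ) + 1) : ℝ) : ℂ))))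
  have h4 : faberResidual G φ γ n w =
      -(w⁻¹ / (((√Real.pi : ℝ) : ℂ) * ((√((n : ℝ) + 1) : ℝ) : ℂ))) *
        ∑' i : ℕ, ((i : ℂ) + 1) * ((n + 1) * grunskyCoeff G φ γ (n + 1) (i + 1)) *
          w⁻¹ ^ (i + 1) := by
    rw [faberResidual, faberDeriv, mul_div_assoc', mul_comm (deriv _ _), h2, hdiv,
      Complex.ofReal_mul]
    push_cast
    rw [← hnn]
    field_simp
    ring
  rw [h4]
  refine h3.congr_fun fun l => ?_
  rw [lp.coeFn_neg, Pi.neg_apply, grunskyRow_apply, grunskyMatrix, exteriorMonomial, hdiv,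
    ← ofReal_sqrt_succ_mul_self l, Complex.ofReal_mul, ← hnn, pow_succ _ (l + 1)]
  field_simp

theorem inner_e_e (n k : ℕ) : inner ℂ (e k) (e n) = if n = k then (1 : ℂ) else 0 := by
  rw [e, lp.inner_single_left, e, lp.single_apply]
  rcases eq_or_ne n k with rfl | h
  · simp
  · simp [h, h.symm]

/-- The Gram matrices of the rows and of the `f_n` in `L²(G)` add up to the identity, the Gram
matrix of the `e n`. -/
theorem exists_grunskyOperator (hφ : IsExteriorRiemannMap G φ γ) (hGo : IsOpen G)
    (hG : Bornology.IsBounded G) (hΓ : volume (frontier G) = 0) :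
    ∃ C : Ell2 →L[ℂ] Ell2, ∀ n, C (e n) = hφ.grunskyRow hG n := by
  refine exists_continuousLinearMap_of_columns
    (d := fun n => (memLp_faberDeriv hG φ γ n).toLp _) fun n k => ?_
  rw [inner_toLp, inner_e_e]
  exact eq_sub_iff_add_eq'.1 (hφ.l2Inner_faberDeriv hGo hG hΓ n k)

end IsExteriorRiemannMap

end BergmanGrunsky

theorem mainTheorem5 (G : Set ℂ) (hG_open : IsOpen G) (hG_bdd : Bornology.IsBounded G)
    (hG_sc : SimplyConnectedSpace G) (φ : ℂ → ℂ) (γ : ℝ)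
    (hφ : BergmanGrunsky.IsExteriorRiemannMap G φ γ)
    (hΓ : volume (frontier G) = 0) :
    -- the Grunsky coefficients are well defined by their generating series
    BergmanGrunsky.IsGrunskyCoeffs (BergmanGrunsky.exteriorInverse G φ) γ
      (BergmanGrunsky.grunskyCoeff G φ γ) ∧
    -- the functions `f_n` and `r_n` are square integrable
    (∀ n : ℕ, MemLp (BergmanGrunsky.faberDeriv φ γ n) 2 (volume.restrict G)) ∧
    (∀ n : ℕ, MemLp (BergmanGrunsky.faberResidual G φ γ n) 2
      (volume.restrict BergmanGrunsky.exteriorDisk)) ∧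
    -- the Grunsky matrix is the matrix of a bounded operator `C` on `ℓ²`, and the identities hold
    ∃ C : BergmanGrunsky.Ell2 →L[ℂ] BergmanGrunsky.Ell2,
      BergmanGrunsky.HasMatrix C (BergmanGrunsky.grunskyMatrix G φ γ) ∧
      ∀ n k : ℕ,
        BergmanGrunsky.l2Inner G (BergmanGrunsky.faberDeriv φ γ n)
            (BergmanGrunsky.faberDeriv φ γ k)
          = (if n = k then 1 else 0)
            - BergmanGrunsky.l2Inner BergmanGrunsky.exteriorDisk
                (BergmanGrunsky.faberResidual G φ γ n) (BergmanGrunsky.faberResidual G φ γ k) ∧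
        BergmanGrunsky.l2Inner G (BergmanGrunsky.faberDeriv φ γ n)
            (BergmanGrunsky.faberDeriv φ γ k)
          = (if n = k then 1 else 0)
            - inner ℂ (BergmanGrunsky.e k)
                ((ContinuousLinearMap.adjoint C) (C (BergmanGrunsky.e n))) := by
  obtain ⟨C, hC⟩ := hφ.exists_grunskyOperator hG_open hG_bdd hΓ
  refine ⟨hφ.isGrunskyCoeffs hG_bdd, BergmanGrunsky.memLp_faberDeriv hG_bdd φ γ,
    fun n => BergmanGrunsky.memLp_of_hasSum (hφ.hasSum_faberResidual hG_bdd n), C,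
    fun j k => ?_, fun n k => ⟨?_, ?_⟩⟩
  -- `C` sends `e k` to the row of index `k`; symmetry of the matrix identifies it with the column.
  · rw [hC, BergmanGrunsky.e, lp.inner_single_left, hφ.grunskyRow_apply,
      hφ.grunskyMatrix_comm hG_bdd]
    simp
  · rw [hφ.l2Inner_faberDeriv hG_open hG_bdd hΓ,
      BergmanGrunsky.l2Inner_of_hasSum (hφ.hasSum_faberResidual hG_bdd n)
        (hφ.hasSum_faberResidual hG_bdd k), inner_neg_neg]
  · rw [hφ.l2Inner_faberDeriv hG_open hG_bdd hΓ, ContinuousLinearMap.adjoint_inner_right, hC, hC]
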